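/- Consider a single-server queue whose interarrival times are i.i.d. copies of $G\ge 0$ and whose service times are i.i.d. copies of $H\ge 0$, the two sequences being independent, operated under the preemptive last-come first-served (LCFS) discipline: every packet starts service immediately on arrival, interrupting any ongoing service, so that a packet is delivered before being overtaken iff the next packet does not arrive before its service is completed. The time-stamp of a packet is its arrival time, $\eta_t$ is the time-stamp of the freshest information delivered by time $t$, and $A_t = t-\eta_t$ is the age of information (AoI). Let $A$ denote the stationary AoI, i.e. a random variable whose distribution function is almost surely the long-run fraction of time, $A(x)=\lim_{T\to\infty}\frac1T\int_0^T \mathbb{1}_{\{A_t\le x\}}\,dt$; it is also the law of $A_t$ when the system is stationary. For a non-negative random variable $Y$ write $y^*(s)=\mathrm{E}[e^{-sY}]$ for its Laplace–Stieltjes transform and $y^{(1)}$ for the derivative of $y^*$. (i) M/GI/1: let $G$ be exponential with rate $\lambda>0$. Then $A$ exists and $$a^*(s)=\frac{\lambda h^*(s+\lambda)}{s+\lambda h^*(s+\lambda)},\qquad s>0.$$ If moreover $0<\mathrm{E}[H]<\infty$ then, with $\rho=\lambda\mathrm{E}[H]$, $A$ has finite first and second moments, and $$\mathrm{E}[A]=\frac{\mathrm{E}[H]}{\rho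 h^*(\lambda)},\qquad \mathrm{E}[A^2]=2\bigl[1-\lambda(-h^{(1)}(\lambda))\bigr]\left(\frac{\mathrm{E}[H]}{\rho h^*(\lambda)}\right)^2.$$ (ii) GI/M/1: let $H$ be exponential with rate $\mu>0$ and $0<\mathrm{E}[G]<\infty$. Then $A$ exists and $$a^*(s)=\tilde g^*(s)\cdot\frac{\mu}{s+\mu},\qquad \tilde g^*(s)=\frac{1-g^*(s)}{s\,\mathrm{E}[G]},\qquad s>0.$$ For every $n\ge1$ with $\mathrm{E}[G^{n+1}]<\infty$, $\mathrm{E}[A^n]$ is finite and $$\mathrm{E}[A^n]=\sum_{m=0}^n\frac{n!\,\mathrm{E}[G^{m+1}](\mathrm{E}[H])^{n-m}}{(m+1)!\,\mathrm{E}[G]}.$$ In particular, $\mathrm{E}[A]=\frac{\mathrm{E}[G^2]}{2\mathrm{E}[G]}+\mathrm{E}[H]$ if $\mathrm{E}[G^2]<\infty$, and $\mathrm{E}[A^2]=\frac{\mathrm{E}[G^3]}{3\mathrm{E}[G]}+2\mathrm{E}[H]\mathrm{E}[A]$ if $\mathrm{E}[G^3]<\infty$. -/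

import Mathlib

open MeasureTheory ProbabilityTheory Filter Topology

noncomputable section

/-- The mean of a distribution on the real line. -/
def distMean (m : Measure ℝ) : ℝ := ∫ x, x ∂m

/-- The `n`-th moment of a distribution on the real line. -/
def distMoment (m : Measure ℝ) (n : ℕ) : ℝ := ∫ x, x ^ n ∂m

/-- The Laplace-Stieltjes transform `s ↦ E[exp (-s Y)]` of the distribution `m` of `Y`. -/
def lst (m : Measure ℝ) (s : ℝ) : ℝ := ∫ x, Real.exp (-(s * x)) ∂m

/-- The Laplace-Stieltjes transform of the residual (equilibrium) distribution of `m`. -/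
def residualLst (m : Measure ℝ) (s : ℝ) : ℝ := (1 - lst m s) / (s * distMean m)

/-- A GI/GI/1 queue with interarrival distribution `mG` and service distribution `mH`, observed
from time `0` on and started from an arbitrary initial state.

Packets are numbered `0, 1, 2, …` in order of arrival. `interarrival n` is the time between the
arrivals of the packets `n` and `n + 1`, and `service n` is the service time of packet `n`.
Packet `0` (which may have arrived before time `0`), the time until the arrival of packet `1`, and
the time-stamp `initialStamp` of the information displayed at the start form the initial state,
which has an arbitrary distribution and may be correlated with everything else; in particular a
queue in its stationary regime is covered. From packet `1` on, interarrival times are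
i.i.d. with distribution `mG`, service times are i.i.d. with distribution `mH`, and the two
sequences are independent. -/
structure GIGIOneQueue {Ω : Type*} [MeasurableSpace Ω] (P : Measure Ω) (mG mH : Measure ℝ) where
  /-- arrival time of packet `0` -/
  firstArrival : Ω → ℝ
  /-- time-stamp of the information displayed before the first delivery -/
  initialStamp : Ω → ℝ
  interarrival : ℕ → Ω → ℝ
  service : ℕ → Ω → ℝ
  measurable_firstArrival : Measurable firstArrival
  measurable_initialStamp : Measurable initialStamp
  measurable_interarrival : ∀ n, Measurable (interarrival n)
  measurable_service : ∀ n, Measurable (service n)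
  initialStamp_nonpos : ∀ ω, initialStamp ω ≤ 0
  initialStamp_le : ∀ ω, initialStamp ω ≤ firstArrival ω
  interarrival_nonneg : ∀ n, ∀ᵐ ω ∂P, 0 ≤ interarrival n ω
  service_nonneg : ∀ n, ∀ᵐ ω ∂P, 0 ≤ service n ω
  law_interarrival : ∀ n, P.map (interarrival (n + 1)) = mG
  law_service : ∀ n, P.map (service (n + 1)) = mH
  indep : iIndepFun
    (Sum.elim (fun n : ℕ => interarrival (n + 1)) (fun n : ℕ => service (n + 1))) P

namespace GIGIOneQueue

variable {Ω : Type*} [MeasurableSpace Ω] {P : Measure Ω} {mG mH : Measure ℝ}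

/-- The arrival time of packet `n`. -/
def arrival (Q : GIGIOneQueue P mG mH) (n : ℕ) (ω : Ω) : ℝ :=
  Q.firstArrival ω + ∑ i ∈ Finset.range n, Q.interarrival i ω

/-- Under preemptive LCFS every packet enters service on arrival, and it is delivered
(is informative) unless the next packet arrives before its service is completed. -/
def Informative (Q : GIGIOneQueue P mG mH) (n : ℕ) (ω : Ω) : Prop :=
  Q.service n ω ≤ Q.interarrival n ω

/-- The time-stamp of the information displayed at time `t` under preemptive LCFS: the latest
among the initial time-stamp and the arrival times of the informative packets whose service is
completed by time `t`. -/
def stamp (Q : GIGIOneQueue P mG mH) (t : ℝ) (ω : Ω) : ℝ :=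
  sSup (insert (Q.initialStamp ω)
    {a : ℝ | ∃ n, Q.Informative n ω ∧ Q.arrival n ω + Q.service n ω ≤ t ∧ a = Q.arrival n ω})

/-- The age of information at time `t` under preemptive LCFS. -/
def aoi (Q : GIGIOneQueue P mG mH) (t : ℝ) (ω : Ω) : ℝ := t - Q.stamp t ω

/-- The fraction of the time interval `[0, T]` in which the age of information is at most `x`. -/
def aoiFraction (Q : GIGIOneQueue P mG mH) (T x : ℝ) (ω : Ω) : ℝ :=
  (1 / T) * ∫ t in (0 : ℝ)..T, Set.indicator (Set.Iic x) (fun _ => (1 : ℝ)) (Q.aoi t ω)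

/-- `ν` is the stationary distribution of the age of information: with probability one, its
distribution function is the long-run fraction of time in which the age is at most `x`; and if
the law of the age at time `t` does not depend on `t`, then that law is `ν`. -/
structure IsAoILaw (Q : GIGIOneQueue P mG mH) (ν : Measure ℝ) : Prop where
  isProbabilityMeasure : IsProbabilityMeasure ν
  longRun : ∀ᵐ ω ∂P, ∀ x : ℝ,
    Tendsto (fun T : ℝ => Q.aoiFraction T x ω) atTop (𝓝 (ν.real (Set.Iic x)))
  stationary : (∀ t : ℝ, 0 ≤ t → P.map (Q.aoi t) = P.map (Q.aoi 0)) →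
    ∀ t : ℝ, 0 ≤ t → P.map (Q.aoi t) = ν

end GIGIOneQueue

end

/-! The age grows at unit rate and drops only at deliveries, so it is driven by the age W_n just
before arrival n and the pair (G_n, H_n). If H_n ≤ G_n, packet n is delivered and W_{n+1} = G_n;
otherwise W_{n+1} = W_n + G_n. Hence V_n = exp(-s W_n) satisfies V_{n+1} = a V_n + b with a = 1{G<H}
e^{-sG} and b = 1{H≤G} e^{-sG}. The integral of exp(-sA) over the n-th interarrival period is (V_n -
V_{n+1} + c (1 - V_n)) / s with c = 1{H≤G} e^{-sH}.

A strong law for sums with predictable weights gives the averages of V and of c (1 - V)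
(`ae_tendsto_average_affine_recursion`). The initial state is immaterial, since the recursion
forgets it at the first delivery. The difference V_n - V_{n+1} telescopes away, and division by the
mean period length yields the long-run average of exp(-sA) as g̃*(s) · E c / (1 - E a)
(`ae_tendsto_average_exp_aoi`).

At s = 1, 2, … these averages are the moments of exp(-A), which lies in [0, 1]; by Weierstrass they
force weak convergence, and the distribution functions converge at every point because the limit has
no atoms (`tendsto_empirical_cdf`). The limit law is constructed: E c / (1 - E a) = ∑ (E a)^n E c is
the transform of a run of overtaken interarrival times followed by one delivered service
(`exists_compound_law`). For Poisson arrivals the residual factor is again exponential; for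
exponential services the second factor collapses to μ / (s + μ).

In GI/M/1 the moments come from the binomial formula for a residual time plus an exponential one. In
M/GI/1 they come from expanding (1 - a*(s)) / s = 1 / (s + λ h*(s + λ)) at s = 0 (`moments_of_lst`).
-/

open MeasureTheory ProbabilityTheory Filter Topology

noncomputable section

/-! ### Strong laws by orthogonality -/

/-- Strong law of large numbers for uniformly bounded orthogonal random variables. -/
theorem ae_tendsto_average_of_orthogonal {Ω : Type*} [MeasurableSpace Ω] {P : Measure Ω}
    [IsProbabilityMeasure P] {D : ℕ → Ω → ℝ} (hm : ∀ n, Measurable (D n))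
    (hb : ∀ n ω, |D n ω| ≤ 1) (horth : ∀ i j, i < j → ∫ ω, D i ω * D j ω ∂P = 0) :
    ∀ᵐ ω ∂P, Tendsto (fun n : ℕ => (n : ℝ)⁻¹ * ∑ i ∈ Finset.range n, D i ω) atTop (𝓝 0) := by
  set S : ℕ → Ω → ℝ := fun n ω => ∑ i ∈ Finset.range n, D i ω with hS
  have hSm : ∀ n, Measurable (S n) := fun n => Finset.measurable_sum _ fun i _ => hm i
  have hSb : ∀ n ω, |S n ω| ≤ n := fun n ω => by
    refine (Finset.abs_sum_le_sum_abs _ _).trans ?_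
    simpa using Finset.sum_le_sum (s := Finset.range n) fun i _ => hb i ω
  have hint : ∀ {f : Ω → ℝ} (_ : Measurable f) (C : ℝ) (_ : ∀ ω, |f ω| ≤ C), Integrable f P :=
    fun hf C hC => Integrable.of_bound hf.aestronglyMeasurable C (Eventually.of_forall hC)
  have hDD : ∀ i j, Integrable (fun ω => D i ω * D j ω) P := fun i j =>
    hint ((hm i).mul (hm j)) 1 fun ω => by
      rw [abs_mul]; exact mul_le_one₀ (hb i ω) (abs_nonneg _) (hb j ω)
  have hSS : ∀ n, Integrable (fun ω => S n ω ^ 2) P := fun n =>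
    hint ((hSm n).pow_const 2) ((n : ℝ) ^ 2) fun ω => by
      rw [abs_pow]; exact pow_le_pow_left₀ (abs_nonneg _) (hSb n ω) 2
  -- Orthogonality kills the cross terms, so the second moment grows at most linearly.
  have hsq : ∀ n : ℕ, ∫ ω, S n ω ^ 2 ∂P ≤ n := by
    intro n
    induction n with
    | zero => simp [hS]
    | succ n ih =>
      have e : ∀ ω, S (n + 1) ω ^ 2 =
          S n ω ^ 2 + (∑ i ∈ Finset.range n, 2 * (D i ω * D n ω) + D n ω * D n ω) := fun ω => by
        simp only [hS, Finset.sum_range_succ, ← Finset.mul_sum, ← Finset.sum_mul]; ring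
      simp only [e]
      have hs : Integrable (fun ω => ∑ i ∈ Finset.range n, 2 * (D i ω * D n ω)) P :=
        integrable_finsetSum _ fun i _ => (hDD i n).const_mul 2
      have hs' : Integrable
          (fun ω => ∑ i ∈ Finset.range n, 2 * (D i ω * D n ω) + D n ω * D n ω) P :=
        hs.add (hDD n n)
      rw [integral_add (hSS n) hs', integral_add hs (hDD n n),
        integral_finsetSum _ fun i _ => (hDD i n).const_mul 2]
      have z : ∑ i ∈ Finset.range n, ∫ ω, 2 * (D i ω * D n ω) ∂P = 0 :=
        Finset.sum_eq_zero fun i hi => by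
          rw [integral_const_mul, horth i n (Finset.mem_range.1 hi), mul_zero]
      have l : ∫ ω, D n ω * D n ω ∂P ≤ ∫ _, (1 : ℝ) ∂P :=
        integral_mono (hDD n n) (integrable_const _) fun ω => by
          have := hb n ω
          rw [← sq, ← sq_abs]; exact pow_le_one₀ (abs_nonneg _) this
      rw [z]
      simp only [integral_const, probReal_univ, smul_eq_mul, mul_one] at l
      push_cast; linarith
  -- Along the squares the second moments of the averages are at most 1 / k², hence summable, and
  -- the terms tend to zero almost surely.
  have hsub : ∀ᵐ ω ∂P, Tendsto (fun k : ℕ => (S (k ^ 2) ω / (k : ℝ) ^ 2) ^ 2) atTop (𝓝 0) := by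
    have hfin : ∫⁻ ω, ∑' k : ℕ, ENNReal.ofReal ((S (k ^ 2) ω / (k : ℝ) ^ 2) ^ 2) ∂P ≠ ⊤ := by
      rw [lintegral_tsum fun k =>
        ((((hSm _).div_const _).pow_const 2).ennreal_ofReal).aemeasurable]
      have hle : ∀ k : ℕ, ∫⁻ ω, ENNReal.ofReal ((S (k ^ 2) ω / (k : ℝ) ^ 2) ^ 2) ∂P
          ≤ ENNReal.ofReal (1 / (k : ℝ) ^ 2) := fun k => by
        have hi : Integrable (fun ω => (S (k ^ 2) ω / (k : ℝ) ^ 2) ^ 2) P := by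
          simp only [div_pow]; exact (hSS _).div_const _
        rw [← ofReal_integral_eq_lintegral_ofReal hi (Eventually.of_forall fun ω => sq_nonneg _)]
        refine ENNReal.ofReal_le_ofReal ?_
        simp only [div_pow]
        rw [integral_div]
        rcases Nat.eq_zero_or_pos k with rfl | hk
        · simp
        · have hk' : (0 : ℝ) < k := by exact_mod_cast hk
          rw [div_le_div_iff₀ (by positivity) (by positivity)]
          have := hsq (k ^ 2)
          push_cast at this
          nlinarith [sq_nonneg (k : ℝ)]
      refine ne_top_of_le_ne_top ?_ (ENNReal.tsum_le_tsum hle)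
      exact (Real.summable_one_div_nat_pow.2 one_lt_two).tsum_ofReal_ne_top
    filter_upwards [ae_lt_top' (AEMeasurable.tsum fun k =>
        ((((hSm _).div_const _).pow_const 2).ennreal_ofReal).aemeasurable) hfin] with ω hω
    have := ENNReal.tendsto_atTop_zero_of_tsum_ne_top hω.ne
    have h2 := (ENNReal.tendsto_toReal ENNReal.zero_ne_top).comp this
    simpa [Function.comp_def, ENNReal.toReal_ofReal, sq_nonneg] using h2
  filter_upwards [hsub] with ω hω
  have h1 : Tendsto (fun k : ℕ => |S (k ^ 2) ω / (k : ℝ) ^ 2| + 2 / (k : ℝ)) atTop (𝓝 0) := by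
    have := (Real.continuous_sqrt.tendsto 0).comp hω
    simp only [Function.comp_def, Real.sqrt_sq_eq_abs, Real.sqrt_zero] at this
    simpa using this.add (tendsto_const_div_atTop_nhds_zero_nat 2)
  have hsqrt : Tendsto Nat.sqrt atTop atTop :=
    tendsto_atTop_atTop.2 fun b => ⟨b ^ 2, fun n hn => Nat.le_sqrt'.2 hn⟩
  refine squeeze_zero_norm' ?_ (h1.comp hsqrt)
  filter_upwards [eventually_ge_atTop 1] with n hn
  set k := Nat.sqrt n with hk
  have hk1 : 1 ≤ k := Nat.le_sqrt'.2 (by simpa using hn)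
  have hkn : k ^ 2 ≤ n := Nat.sqrt_le' n
  -- Between consecutive squares there are at most 2k further terms, each bounded by 1: negligible
  -- against k².
  have hnk : n ≤ k ^ 2 + 2 * k := by have := Nat.sqrt_le_add n; rw [← hk] at this; nlinarith
  have hdiff : |S n ω| ≤ |S (k ^ 2) ω| + 2 * k := by
    have e : S n ω = S (k ^ 2) ω + ∑ i ∈ Finset.Ico (k ^ 2) n, D i ω :=
      (Finset.sum_range_add_sum_Ico _ hkn).symm
    have : |∑ i ∈ Finset.Ico (k ^ 2) n, D i ω| ≤ 2 * k := by
      refine (Finset.abs_sum_le_sum_abs _ _).trans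
        ((Finset.sum_le_sum (s := Finset.Ico (k ^ 2) n) fun i _ => hb i ω).trans ?_)
      simp only [Finset.sum_const, Nat.card_Ico, nsmul_eq_mul, mul_one]
      have : n - k ^ 2 ≤ 2 * k := by omega
      exact_mod_cast this
    rw [e]
    exact (abs_add_le _ _).trans (by linarith)
  have hkp : (0 : ℝ) < k := by exact_mod_cast hk1
  have hnp : (k : ℝ) ^ 2 ≤ n := by exact_mod_cast hkn
  simp only [Function.comp_apply, Real.norm_eq_abs, ← hk]
  rw [abs_mul, abs_inv, Nat.abs_cast, abs_div, abs_of_pos (pow_pos hkp 2)]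
  calc (n : ℝ)⁻¹ * |S n ω| ≤ ((k : ℝ) ^ 2)⁻¹ * (|S (k ^ 2) ω| + 2 * k) :=
        mul_le_mul (inv_anti₀ (by positivity) hnp) hdiff (abs_nonneg _) (by positivity)
    _ = |S (k ^ 2) ω| / (k : ℝ) ^ 2 + 2 / k := by field_simp

/-! ### Averages along i.i.d. sequences and affine recursions -/

section IIDSequence

variable {Ω E : Type*} [MeasurableSpace Ω] [mE : MeasurableSpace E] {P : Measure Ω}
  [IsProbabilityMeasure P] {X : ℕ → Ω → E} {m : Measure E}

/-- The information carried by the first `n` members of a sequence of random variables. -/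
abbrev past (X : ℕ → Ω → E) (n : ℕ) : MeasurableSpace Ω := ⨆ k ∈ Set.Iio n, mE.comap (X k)

lemma past_mono {Ω E : Type*} [mE : MeasurableSpace E] (X : ℕ → Ω → E) {i j : ℕ} (h : i ≤ j) : past X i ≤ past X j :=
  biSup_mono fun _ hk => lt_of_lt_of_le hk h

lemma past_le (hX : ∀ n, Measurable (X n)) (n : ℕ) : past X n ≤ ‹MeasurableSpace Ω› :=
  iSup₂_le fun k _ => (hX k).comap_le

lemma measurable_past {Ω E : Type*} [mE : MeasurableSpace E] (X : ℕ → Ω → E) {k n : ℕ} (h : k < n) : Measurable[past X n] (X k) :=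
  (comap_measurable (X k)).mono (le_iSup₂_of_le (f := fun k (_ : k ∈ Set.Iio n) => mE.comap (X k))
    k h le_rfl) le_rfl

/-- Law of large numbers for `∑ U i * f (X i)` with predictable bounded weights `U i`. -/
theorem ae_tendsto_average_predictable (hX : ∀ n, Measurable (X n)) (hlaw : ∀ n, P.map (X n) = m)
    (hind : ∀ n, Indep (past X n) (mE.comap (X n)) P) {U : ℕ → Ω → ℝ}
    (hU : ∀ n, Measurable[past X n] (U n)) (hU0 : ∀ n ω, 0 ≤ U n ω) (hU1 : ∀ n ω, U n ω ≤ 1)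
    {f : E → ℝ} (hf : Measurable f) (hf0 : ∀ x, 0 ≤ f x) (hf1 : ∀ x, f x ≤ 1) :
    ∀ᵐ ω ∂P, Tendsto (fun n : ℕ => (n : ℝ)⁻¹ *
      ∑ i ∈ Finset.range n, U i ω * (f (X i ω) - ∫ x, f x ∂m)) atTop (𝓝 0) := by
  have hprob : IsProbabilityMeasure m := by
    rw [← hlaw 0]; exact Measure.isProbabilityMeasure_map (hX 0).aemeasurable
  have hfi : Integrable f m := Integrable.of_bound hf.aestronglyMeasurable 1
    (Eventually.of_forall fun x => by rw [Real.norm_eq_abs, abs_of_nonneg (hf0 x)]; exact hf1 x)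
  set c := ∫ x, f x ∂m with hc
  have hc0 : 0 ≤ c := integral_nonneg hf0
  have hc1 : c ≤ 1 := by
    have := integral_mono hfi (integrable_const 1) hf1
    simpa using this
  have hfc : ∀ x, |f x - c| ≤ 1 := fun x => by
    rw [abs_le]; constructor <;> linarith [hf0 x, hf1 x]
  have hUm : ∀ n, Measurable (U n) := fun n => (hU n).mono (past_le hX n) le_rfl
  refine ae_tendsto_average_of_orthogonal
    (fun n => (hUm n).mul ((hf.comp (hX n)).sub_const c)) (fun n ω => ?_) fun i j hij => ?_
  · rw [abs_mul, abs_of_nonneg (hU0 n ω)]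
    exact mul_le_one₀ (hU1 n ω) (abs_nonneg _) (hfc _)
  · have e : ∀ ω, U i ω * (f (X i ω) - c) * (U j ω * (f (X j ω) - c)) =
        (fun ω => U i ω * (f (X i ω) - c) * U j ω) ω * (fun ω => f (X j ω) - c) ω := fun ω => by
      ring
    simp only [e]
    have hpast : Measurable[past X j] fun ω => U i ω * (f (X i ω) - c) * U j ω :=
      (((hU i).mono (past_mono X hij.le) le_rfl).mul
        ((hf.comp (measurable_past X hij)).sub_const c)).mul (hU j)
    have hindep : IndepFun (fun ω => U i ω * (f (X i ω) - c) * U j ω)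
        (fun ω => f (X j ω) - c) P := by
      rw [IndepFun_iff_Indep]
      exact indep_of_indep_of_le_left (indep_of_indep_of_le_right (hind j)
        (((hf.sub_const c).comp (comap_measurable (X j))).comap_le)) hpast.comap_le
    rw [hindep.integral_fun_mul_eq_mul_integral
      (hpast.mono (past_le hX j) le_rfl).aestronglyMeasurable
      ((hf.comp (hX j)).sub_const c).aestronglyMeasurable]
    have : ∫ ω, (f (X j ω) - c) ∂P = 0 := by
      have h := integral_map (μ := P) (hX j).aemeasurable (f := fun x => f x - c)
        (hf.sub_const c).aestronglyMeasurable
      rw [← h, hlaw j, integral_sub hfi (integrable_const _)]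
      simp [hc]
    rw [this, mul_zero]

/-- Law of large numbers for bounded functions of an i.i.d. sequence. -/
theorem ae_tendsto_average (hX : ∀ n, Measurable (X n)) (hlaw : ∀ n, P.map (X n) = m)
    (hind : ∀ n, Indep (past X n) (mE.comap (X n)) P)
    {f : E → ℝ} (hf : Measurable f) (hf0 : ∀ x, 0 ≤ f x) (hf1 : ∀ x, f x ≤ 1) :
    ∀ᵐ ω ∂P, Tendsto (fun n : ℕ => (n : ℝ)⁻¹ * ∑ i ∈ Finset.range n, f (X i ω)) atTop
      (𝓝 (∫ x, f x ∂m)) := by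
  filter_upwards [ae_tendsto_average_predictable hX hlaw hind (U := fun _ _ => 1)
    (fun n => measurable_const) (fun _ _ => zero_le_one) (fun _ _ => le_rfl) hf hf0 hf1] with ω h
  rw [← tendsto_sub_nhds_zero_iff]
  refine h.congr' ?_
  filter_upwards [eventually_ge_atTop 1] with n hn
  have : (n : ℝ) ≠ 0 := by positivity
  simp only [one_mul, Finset.sum_sub_distrib, Finset.sum_const, Finset.card_range, nsmul_eq_mul]
  field_simp

/-- Averages along the random affine recursion `V (n + 1) = V n * a (X n) + b (X n)`. -/
theorem ae_tendsto_average_affine_recursion (hX : ∀ n, Measurable (X n))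
    (hlaw : ∀ n, P.map (X n) = m) (hind : ∀ n, Indep (past X n) (mE.comap (X n)) P)
    {a b c : E → ℝ} (ha : Measurable a) (hb : Measurable b) (hc : Measurable c)
    (ha0 : ∀ x, 0 ≤ a x) (hb0 : ∀ x, 0 ≤ b x) (hc0 : ∀ x, 0 ≤ c x) (hab : ∀ x, a x + b x ≤ 1)
    (hc1 : ∀ x, c x ≤ 1) (hz : m {x | a x = 0} ≠ 0) :
    ∀ᵐ ω ∂P, ∀ V : ℕ → ℝ, (∀ n, V (n + 1) = V n * a (X n ω) + b (X n ω)) →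
      Tendsto (fun n : ℕ => (n : ℝ)⁻¹ * ∑ i ∈ Finset.range n, c (X i ω) * (1 - V i)) atTop
        (𝓝 ((∫ x, c x ∂m) * (1 - (∫ x, b x ∂m) / (1 - ∫ x, a x ∂m)))) := by
  have hprob : IsProbabilityMeasure m := by
    rw [← hlaw 0]; exact Measure.isProbabilityMeasure_map (hX 0).aemeasurable
  have ha1 : ∀ x, a x ≤ 1 := fun x => by linarith [hab x, hb0 x]
  have hb1 : ∀ x, b x ≤ 1 := fun x => by linarith [hab x, ha0 x]
  -- The given `V` may depend on an initial value correlated with everything. `U`, the same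
  -- recursion started from 0, is predictable, so the strong law applies to it.
  let U : ℕ → Ω → ℝ := fun n => Nat.rec (fun _ => 0) (fun k u ω => u ω * a (X k ω) + b (X k ω)) n
  have hUs : ∀ n ω, U (n + 1) ω = U n ω * a (X n ω) + b (X n ω) := fun n ω => rfl
  have hU : ∀ n, Measurable[past X n] (U n) := by
    intro n
    induction n with
    | zero => exact measurable_const
    | succ n ih =>
      exact ((ih.mono (past_mono X n.le_succ) le_rfl).mul
        (ha.comp (measurable_past X n.lt_succ_self))).add
        (hb.comp (measurable_past X n.lt_succ_self))
  have hU01 : ∀ n ω, 0 ≤ U n ω ∧ U n ω ≤ 1 := by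
    intro n ω
    induction n with
    | zero => exact ⟨le_rfl, zero_le_one⟩
    | succ n ih =>
      rw [hUs]
      refine ⟨add_nonneg (mul_nonneg ih.1 (ha0 _)) (hb0 _), ?_⟩
      have := mul_le_mul_of_nonneg_right ih.2 (ha0 (X n ω))
      linarith [hab (X n ω)]
  have hA : MeasurableSet {x | a x = 0} := ha (measurableSet_singleton 0)
  have hai : Integrable a m := Integrable.of_bound ha.aestronglyMeasurable 1
    (Eventually.of_forall fun x => by rw [Real.norm_eq_abs, abs_of_nonneg (ha0 x)]; exact ha1 x)
  have hpos : 0 < m.real {x | a x = 0} :=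
    ENNReal.toReal_pos hz (measure_ne_top _ _)
  have hEa : ∫ x, a x ∂m < 1 := by
    have h1 : ∫ x, a x ∂m ≤ ∫ x, (1 - ({x | a x = 0} : Set E).indicator (fun _ => (1 : ℝ)) x) ∂m :=
      integral_mono hai ((integrable_const _).sub ((integrable_const _).indicator hA)) fun x => by
        by_cases h : a x = 0
        · simp [h]
        · simp [h, ha1 x]
    rw [integral_sub (integrable_const _) ((integrable_const _).indicator hA),
      integral_indicator_const _ hA] at h1
    simp only [integral_const, probReal_univ, smul_eq_mul, mul_one] at h1
    linarith
  filter_upwards [ae_tendsto_average hX hlaw hind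
      (f := ({x | a x = 0} : Set E).indicator fun _ => (1 : ℝ)) (measurable_const.indicator hA)
      (fun x => Set.indicator_nonneg (fun _ _ => zero_le_one) x)
      (fun x => Set.indicator_le_self' (fun _ _ => zero_le_one) x),
    ae_tendsto_average hX hlaw hind hb hb0 hb1, ae_tendsto_average hX hlaw hind hc hc0 hc1,
    ae_tendsto_average_predictable hX hlaw hind hU (fun n ω => (hU01 n ω).1)
      (fun n ω => (hU01 n ω).2) ha ha0 ha1,
    ae_tendsto_average_predictable hX hlaw hind hU (fun n ω => (hU01 n ω).1)
      (fun n ω => (hU01 n ω).2) hc hc0 hc1] with ω hω hωb hωc hωUa hωUc V hV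
  -- The frequency of `a = 0` has a positive limit, so it occurs; from the next index on, `V` and
  -- `U` coincide.
  obtain ⟨n₀, hn₀⟩ : ∃ n, a (X n ω) = 0 := by
    by_contra! hne
    have h0 : (fun n : ℕ => (n : ℝ)⁻¹ * ∑ i ∈ Finset.range n,
        ({x | a x = 0} : Set E).indicator (fun _ => (1 : ℝ)) (X i ω)) = fun _ => 0 := by
      funext n
      simp [hne]
    rw [h0, integral_indicator_const _ hA] at hω
    have := tendsto_nhds_unique hω tendsto_const_nhds
    simp only [smul_eq_mul, mul_one] at this
    linarith
  have hVU : ∀ n, n₀ + 1 ≤ n → V n = U n ω := by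
    intro n hn
    induction n, hn using Nat.le_induction with
    | base => rw [hV, hUs, hn₀]; ring
    | succ n _ ih => rw [hV, hUs, ih]
  -- Summing the recursion gives ∑ U a + ∑ b = ∑ U + U_n. Replacing `a` by its mean costs o(n), so
  -- (1 - E a) times the average of `U` tends to E b.
  have hUavg : Tendsto (fun n : ℕ => (n : ℝ)⁻¹ * ∑ i ∈ Finset.range n, U i ω) atTop
      (𝓝 ((∫ x, b x ∂m) / (1 - ∫ x, a x ∂m))) := by
    have hlim : Tendsto (fun n : ℕ => (n : ℝ)⁻¹ * U n ω) atTop (𝓝 0) := by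
      refine squeeze_zero (fun n => mul_nonneg (by positivity) (hU01 n ω).1) (fun n => ?_)
        tendsto_inv_atTop_nhds_zero_nat
      exact mul_le_of_le_one_right (by positivity) (hU01 n ω).2
    have h2 := ((hωUa.add hωb).sub hlim).div_const (1 - ∫ x, a x ∂m)
    simp only [zero_add, sub_zero] at h2
    refine h2.congr fun n => ?_
    have hne : 1 - ∫ x, a x ∂m ≠ 0 := by linarith
    have tel : ∑ i ∈ Finset.range n, (U i ω * a (X i ω) + b (X i ω)) =
        ∑ i ∈ Finset.range n, U i ω + U n ω := by
      have h3 := Finset.sum_range_succ' (fun i => U i ω) n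
      rw [Finset.sum_range_succ] at h3
      rw [h3]
      exact (add_zero _).symm
    rw [Finset.sum_add_distrib] at tel
    rw [div_eq_iff hne, ← mul_add, ← mul_sub, mul_assoc]
    congr 1
    simp only [mul_sub, Finset.sum_sub_distrib, ← Finset.sum_mul]
    linear_combination tel
  have hdiff : Tendsto (fun n : ℕ => (n : ℝ)⁻¹ * ∑ i ∈ Finset.range n,
      c (X i ω) * (U i ω - V i)) atTop (𝓝 0) := by
    refine Filter.Tendsto.cesaro (tendsto_const_nhds.congr' ?_)
    filter_upwards [eventually_ge_atTop (n₀ + 1)] with n hn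
    rw [hVU n hn]; ring
  have key := ((hωc.sub hωUc).sub (hUavg.mul_const (∫ x, c x ∂m))).add hdiff
  refine (key.congr fun n => ?_).trans (le_of_eq (by congr 1; ring))
  rw [mul_assoc, ← mul_sub, ← mul_sub, ← mul_add]
  congr 1
  rw [Finset.sum_mul, ← Finset.sum_sub_distrib, ← Finset.sum_sub_distrib, ← Finset.sum_add_distrib]
  exact Finset.sum_congr rfl fun i _ => by ring

end IIDSequence

/-! ### From averages over periods to time averages -/

/-- A bounded function whose integrals up to the points `τ n` grow like `j * n`, where `τ n` grows
like `r * n`, has the long-run time average `j / r`. -/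
theorem tendsto_time_average {f : ℝ → ℝ} (hf : Measurable f) (hf1 : ∀ t, |f t| ≤ 1)
    {τ : ℕ → ℝ} {r j : ℝ} (hr : 0 < r)
    (hτ : Tendsto (fun n : ℕ => (n : ℝ)⁻¹ * τ n) atTop (𝓝 r))
    (hJ : Tendsto (fun n : ℕ => (n : ℝ)⁻¹ * ∫ t in τ 0..τ n, f t) atTop (𝓝 j)) :
    Tendsto (fun T : ℝ => (1 / T) * ∫ t in (0 : ℝ)..T, f t) atTop (𝓝 (j / r)) := by
  have hi : ∀ a b, IntervalIntegrable f volume a b := fun a b =>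
    (intervalIntegrable_const (c := (1 : ℝ))).mono_fun hf.aestronglyMeasurable
      (Eventually.of_forall fun t => by simpa using hf1 t)
  have hr' : 0 ≤ r⁻¹ := by positivity
  -- The index ⌊T / r⌋ is used instead of a counting process, so no monotonicity of `τ` is needed:
  -- `τ` at that index is T + o(T), and the leftover piece is negligible for bounded `f`.
  have hN : Tendsto (fun T : ℝ => (⌊r⁻¹ * T⌋₊ : ℝ) / T) atTop (𝓝 r⁻¹) :=
    tendsto_nat_floor_mul_div_atTop hr'
  have hNat : Tendsto (fun T : ℝ => ⌊r⁻¹ * T⌋₊) atTop atTop :=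
    tendsto_nat_floor_atTop.comp (tendsto_id.const_mul_atTop (inv_pos.2 hr))
  have h1 := (hτ.comp hNat).mul hN
  have h2 := (hJ.comp hNat).mul hN
  rw [mul_inv_cancel₀ hr.ne'] at h1
  have h3 : Tendsto (fun T : ℝ => T⁻¹ * ∫ t in (0 : ℝ)..τ 0, f t) atTop (𝓝 0) := by
    simpa using tendsto_inv_atTop_zero.mul_const (∫ t in (0 : ℝ)..τ 0, f t)
  have h4 : Tendsto (fun T : ℝ => T⁻¹ * ∫ t in τ ⌊r⁻¹ * T⌋₊..T, f t) atTop (𝓝 0) := by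
    have h5 : Tendsto (fun T : ℝ => |1 - ((⌊r⁻¹ * T⌋₊ : ℝ)⁻¹ * τ ⌊r⁻¹ * T⌋₊) *
        ((⌊r⁻¹ * T⌋₊ : ℝ) / T)|) atTop (𝓝 0) := by
      simpa [Function.comp_def] using (h1.const_sub 1).abs
    refine squeeze_zero_norm' ?_ h5
    filter_upwards [eventually_gt_atTop 0, hNat.eventually_ge_atTop 1] with T hT hn
    have hn0 : (⌊r⁻¹ * T⌋₊ : ℝ) ≠ 0 := by positivity
    have hb : ‖∫ t in τ ⌊r⁻¹ * T⌋₊..T, f t‖ ≤ 1 * |T - τ ⌊r⁻¹ * T⌋₊| :=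
      intervalIntegral.norm_integral_le_of_norm_le_const fun t _ => hf1 t
    have e : 1 - ((⌊r⁻¹ * T⌋₊ : ℝ)⁻¹ * τ ⌊r⁻¹ * T⌋₊) * ((⌊r⁻¹ * T⌋₊ : ℝ) / T) =
        T⁻¹ * (T - τ ⌊r⁻¹ * T⌋₊) := by
      generalize ⌊r⁻¹ * T⌋₊ = N at hn0 ⊢
      field_simp
    rw [e, norm_mul, abs_mul, Real.norm_eq_abs]
    exact mul_le_mul_of_nonneg_left (by simpa using hb) (abs_nonneg _)
  have key := (h3.add h2).add h4
  simp only [zero_add, add_zero] at key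
  rw [div_eq_mul_inv]
  refine key.congr' ?_
  filter_upwards [eventually_gt_atTop 0, hNat.eventually_ge_atTop 1] with T hT hn
  have hn0 : (⌊r⁻¹ * T⌋₊ : ℝ) ≠ 0 := by positivity
  rw [← intervalIntegral.integral_add_adjacent_intervals (hi 0 (τ ⌊r⁻¹ * T⌋₊)) (hi _ T),
    ← intervalIntegral.integral_add_adjacent_intervals (hi 0 (τ 0))
      (hi (τ 0) (τ ⌊r⁻¹ * T⌋₊))]
  simp only [Function.comp_apply]
  generalize ⌊r⁻¹ * T⌋₊ = N at hn0 ⊢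
  field_simp

lemma integral_exp_neg_mul_sub {s : ℝ} (hs : s ≠ 0) (p q r : ℝ) :
    ∫ t in p..q, Real.exp (-(s * (t - r))) =
      (Real.exp (-(s * (p - r))) - Real.exp (-(s * (q - r)))) / s := by
  have hd : ∀ t : ℝ, HasDerivAt (fun t => -Real.exp (-(s * (t - r))) / s)
      (Real.exp (-(s * (t - r)))) t := fun t => by
    have h := ((((hasDerivAt_id t).sub_const r).const_mul s).neg.exp.neg.div_const s)
    simp only [id_eq, Pi.neg_apply] at h
    convert! h using 1
    field_simp
  rw [intervalIntegral.integral_eq_sub_of_hasDerivAt (fun t _ => hd t)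
    (Continuous.intervalIntegrable (by fun_prop) _ _)]
  ring

/-! ### Sample paths of the age -/

namespace GIGIOneQueue

variable {Ω : Type*} [MeasurableSpace Ω] {P : Measure Ω} {mG mH : Measure ℝ}
  (Q : GIGIOneQueue P mG mH)

open scoped Classical in
/-- The stamp displayed when packet `n` arrives. -/
def heldStamp (ω : Ω) : ℕ → ℝ
  | 0 => Q.initialStamp ω
  | n + 1 => if Q.Informative n ω then Q.arrival n ω else heldStamp ω n

lemma arrival_succ (n : ℕ) (ω : Ω) :
    Q.arrival (n + 1) ω = Q.arrival n ω + Q.interarrival n ω := by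
  simp only [arrival, Finset.sum_range_succ]; ring

lemma measurable_arrival (n : ℕ) : Measurable (Q.arrival n) :=
  Q.measurable_firstArrival.add (Finset.measurable_sum _ fun i _ => Q.measurable_interarrival i)

/-- The age is jointly measurable in time and randomness. -/
lemma measurable_aoi_uncurry : Measurable fun p : ℝ × Ω => Q.aoi p.1 p.2 := by
  classical
  -- An undelivered packet contributes the initial stamp, already a member of the set. The range of
  -- `F` is then exactly the set in `stamp`, which becomes a countable supremum of measurable
  -- functions.
  let F : Option ℕ → ℝ × Ω → ℝ := fun o p => o.elim (Q.initialStamp p.2) fun n =>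
    if Q.Informative n p.2 ∧ Q.arrival n p.2 + Q.service n p.2 ≤ p.1 then Q.arrival n p.2
    else Q.initialStamp p.2
  have hF : ∀ o, Measurable (F o) := by
    rintro (_ | n)
    · exact Q.measurable_initialStamp.comp measurable_snd
    · refine Measurable.ite ?_ ((Q.measurable_arrival n).comp measurable_snd)
        (Q.measurable_initialStamp.comp measurable_snd)
      exact (measurableSet_le ((Q.measurable_service n).comp measurable_snd)
        ((Q.measurable_interarrival n).comp measurable_snd)).inter
        (measurableSet_le (((Q.measurable_arrival n).add (Q.measurable_service n)).comp
          measurable_snd) measurable_fst)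
  have e : (fun p : ℝ × Ω => Q.aoi p.1 p.2) = fun p => p.1 - ⨆ o, F o p := by
    funext p
    rw [aoi, stamp, iSup]
    congr 2
    ext a
    simp only [Set.mem_insert_iff, Set.mem_ofPred_eq, Set.mem_range]
    constructor
    · rintro (rfl | ⟨n, h1, h2, rfl⟩)
      · exact ⟨none, rfl⟩
      · exact ⟨some n, if_pos ⟨h1, h2⟩⟩
    · rintro ⟨_ | n, rfl⟩
      · exact Or.inl rfl
      · by_cases h : Q.Informative n p.2 ∧ Q.arrival n p.2 + Q.service n p.2 ≤ p.1
        · exact Or.inr ⟨n, h.1, h.2, if_pos h⟩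
        · exact Or.inl (if_neg h)
  rw [e]
  exact measurable_fst.sub (Measurable.iSup hF)

lemma measurable_aoi (t : ℝ) : Measurable (Q.aoi t) :=
  Q.measurable_aoi_uncurry.comp measurable_prodMk_left

lemma measurable_aoi_path (ω : Ω) : Measurable fun t => Q.aoi t ω :=
  Q.measurable_aoi_uncurry.comp measurable_prodMk_right

section Path

variable {Q} {ω : Ω} (hI : ∀ n, 0 ≤ Q.interarrival n ω) (hS : ∀ n, 0 ≤ Q.service n ω)
include hI

lemma arrival_mono : Monotone fun n => Q.arrival n ω :=
  monotone_nat_of_le_succ fun n => by rw [arrival_succ]; linarith [hI n]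

lemma initialStamp_le_arrival (n : ℕ) : Q.initialStamp ω ≤ Q.arrival n ω :=
  (Q.initialStamp_le ω).trans (by simpa [arrival] using arrival_mono hI n.zero_le)

lemma initialStamp_le_heldStamp (n : ℕ) : Q.initialStamp ω ≤ Q.heldStamp ω n := by
  induction n with
  | zero => exact le_rfl
  | succ n ih =>
    rw [heldStamp]
    split_ifs
    exacts [initialStamp_le_arrival hI n, ih]

lemma heldStamp_le_arrival (n : ℕ) : Q.heldStamp ω n ≤ Q.arrival n ω := by
  induction n with
  | zero => exact initialStamp_le_arrival hI 0
  | succ n ih =>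
    rw [heldStamp]
    have := arrival_mono hI n.le_succ
    split_ifs
    exacts [this, ih.trans this]

lemma arrival_le_heldStamp {k n : ℕ} (hk : Q.Informative k ω) (hkn : k < n) :
    Q.arrival k ω ≤ Q.heldStamp ω n := by
  induction n, Nat.succ_le_of_lt hkn using Nat.le_induction with
  | base => rw [Nat.succ_eq_add_one, heldStamp, if_pos hk]
  | succ n hn ih =>
    rw [heldStamp]
    split_ifs
    exacts [arrival_mono hI (by omega), ih (by omega)]

omit hI in
lemma heldStamp_eq (n : ℕ) : Q.heldStamp ω n = Q.initialStamp ω ∨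
    ∃ k < n, Q.Informative k ω ∧ Q.heldStamp ω n = Q.arrival k ω := by
  induction n with
  | zero => exact Or.inl rfl
  | succ n ih =>
    rw [heldStamp]
    split_ifs with h
    · exact Or.inr ⟨n, n.lt_succ_self, h, rfl⟩
    · rcases ih with h' | ⟨k, hk, h1, h2⟩
      · exact Or.inl h'
      · exact Or.inr ⟨k, hk.trans n.lt_succ_self, h1, h2⟩

/-- An informative packet k < n completes service by arrival k + 1, hence by arrival n. -/
lemma heldStamp_mem {n : ℕ} {t : ℝ} (ht : Q.arrival n ω ≤ t) :
    Q.heldStamp ω n ∈ insert (Q.initialStamp ω) {a : ℝ | ∃ n, Q.Informative n ω ∧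
      Q.arrival n ω + Q.service n ω ≤ t ∧ a = Q.arrival n ω} := by
  rcases heldStamp_eq (Q := Q) (ω := ω) n with h | ⟨k, hk, h1, h2⟩
  · exact Or.inl h
  · refine Or.inr ⟨k, h1, le_trans ?_ ht, h2⟩
    have h3 := arrival_mono hI (Nat.succ_le_of_lt hk)
    simp only [Nat.succ_eq_add_one, arrival_succ] at h3
    have : Q.service k ω ≤ Q.interarrival k ω := h1
    linarith

include hS

/-- Packet n is still in service and later packets have not arrived, so only packets before n count,
and the newest informative one among them is the held stamp. -/
lemma stamp_of_lt {n : ℕ} {t : ℝ} (h1 : Q.arrival n ω ≤ t) (h2 : t < Q.arrival (n + 1) ω)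
    (h3 : t < Q.arrival n ω + Q.service n ω) : Q.stamp t ω = Q.heldStamp ω n := by
  refine IsGreatest.csSup_eq ⟨heldStamp_mem hI h1, ?_⟩
  rintro a (rfl | ⟨k, hk, hkt, rfl⟩)
  · exact initialStamp_le_heldStamp hI n
  · rcases lt_trichotomy k n with h | rfl | h
    · exact arrival_le_heldStamp hI hk h
    · linarith
    · have := arrival_mono hI (Nat.succ_le_of_lt h)
      simp only [Nat.succ_eq_add_one] at this
      linarith [hS k]

/-- Completion before the next arrival makes packet n informative, and no newer packet has arrived
by time t. -/
lemma stamp_of_ge {n : ℕ} {t : ℝ} (h2 : t < Q.arrival (n + 1) ω)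
    (h3 : Q.arrival n ω + Q.service n ω ≤ t) : Q.stamp t ω = Q.arrival n ω := by
  refine IsGreatest.csSup_eq ⟨Or.inr ⟨n, ?_, h3, rfl⟩, ?_⟩
  · rw [arrival_succ] at h2
    rw [Informative]; linarith
  rintro a (rfl | ⟨k, hk, hkt, rfl⟩)
  · exact initialStamp_le_arrival hI n
  · rcases le_or_gt k n with h | h
    · exact arrival_mono hI h
    · have := arrival_mono hI (Nat.succ_le_of_lt h)
      simp only [Nat.succ_eq_add_one] at this
      linarith [hS k]

omit hI in
lemma aoi_nonneg {t : ℝ} (ht : Q.initialStamp ω ≤ t) : 0 ≤ Q.aoi t ω := by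
  refine sub_nonneg.2 (csSup_le (Set.insert_nonempty _ _) ?_)
  rintro a (rfl | ⟨k, hk, hkt, rfl⟩)
  · exact ht
  · linarith [hS k]

/-- The contribution of one interarrival period to the integral of `exp (-s A)`. -/
lemma integral_exp_aoi_period {s : ℝ} (hs : s ≠ 0) (n : ℕ) :
    ∫ t in Q.arrival n ω..Q.arrival (n + 1) ω, Real.exp (-(s * |Q.aoi t ω|)) =
      (Real.exp (-(s * (Q.arrival n ω - Q.heldStamp ω n)))
        - Real.exp (-(s * (Q.arrival (n + 1) ω - Q.heldStamp ω (n + 1))))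
        + {p : ℝ × ℝ | p.2 ≤ p.1}.indicator (fun p => Real.exp (-(s * p.2)))
          (Q.interarrival n ω, Q.service n ω)
          * (1 - Real.exp (-(s * (Q.arrival n ω - Q.heldStamp ω n))))) / s := by
  have hmono : Q.arrival n ω ≤ Q.arrival (n + 1) ω := arrival_mono hI n.le_succ
  have habs : ∀ t, Q.arrival n ω ≤ t → |Q.aoi t ω| = Q.aoi t ω := fun t ht =>
    abs_of_nonneg (aoi_nonneg hS ((initialStamp_le_arrival hI n).trans ht))
  by_cases hinf : Q.Informative n ω
  · have hle : Q.service n ω ≤ Q.interarrival n ω := hinf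
    have hA := Q.arrival_succ n ω
    -- With W the age on arrival, a delivered packet makes the age run from W to W + H, drop to H,
    -- then run to G.
    have c1 : Set.EqOn (fun t => Real.exp (-(s * |Q.aoi t ω|)))
        (fun t => Real.exp (-(s * (t - Q.heldStamp ω n))))
        (Set.Ioo (Q.arrival n ω) (Q.arrival n ω + Q.service n ω)) := fun t ht => by
      simp only
      rw [habs t ht.1.le, aoi, stamp_of_lt hI hS ht.1.le (by linarith [ht.2]) ht.2]
    have c2 : Set.EqOn (fun t => Real.exp (-(s * |Q.aoi t ω|)))
        (fun t => Real.exp (-(s * (t - Q.arrival n ω))))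
        (Set.Ioo (Q.arrival n ω + Q.service n ω) (Q.arrival (n + 1) ω)) := fun t ht => by
      have : Q.arrival n ω ≤ t := by linarith [ht.1, hS n]
      simp only
      rw [habs t this, aoi, stamp_of_ge hI hS ht.2 ht.1.le]
    have l1 : Q.arrival n ω ≤ Q.arrival n ω + Q.service n ω := by linarith [hS n]
    have l2 : Q.arrival n ω + Q.service n ω ≤ Q.arrival (n + 1) ω := by linarith
    have i1 : IntervalIntegrable (fun t => Real.exp (-(s * |Q.aoi t ω|))) volume
        (Q.arrival n ω) (Q.arrival n ω + Q.service n ω) := by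
      rw [intervalIntegrable_iff_integrableOn_Ioo_of_le l1, integrableOn_congr_fun c1
        measurableSet_Ioo, ← intervalIntegrable_iff_integrableOn_Ioo_of_le l1]
      exact Continuous.intervalIntegrable (by fun_prop) _ _
    have i2 : IntervalIntegrable (fun t => Real.exp (-(s * |Q.aoi t ω|))) volume
        (Q.arrival n ω + Q.service n ω) (Q.arrival (n + 1) ω) := by
      rw [intervalIntegrable_iff_integrableOn_Ioo_of_le l2, integrableOn_congr_fun c2
        measurableSet_Ioo, ← intervalIntegrable_iff_integrableOn_Ioo_of_le l2]
      exact Continuous.intervalIntegrable (by fun_prop) _ _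
    rw [← intervalIntegral.integral_add_adjacent_intervals i1 i2,
      intervalIntegral.integral_congr_Ioo_of_le l1 c1,
      intervalIntegral.integral_congr_Ioo_of_le l2 c2, integral_exp_neg_mul_sub hs,
      integral_exp_neg_mul_sub hs, heldStamp, if_pos hinf,
      Set.indicator_of_mem (show (Q.interarrival n ω, Q.service n ω) ∈ {p : ℝ × ℝ | p.2 ≤ p.1}
        from hle)]
    have e : Real.exp (-(s * (Q.arrival n ω + Q.service n ω - Q.heldStamp ω n))) =
        Real.exp (-(s * Q.service n ω)) * Real.exp (-(s * (Q.arrival n ω - Q.heldStamp ω n))) := by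
      rw [← Real.exp_add]; congr 1; ring
    rw [e, add_sub_cancel_left]
    ring
  · have hlt : ¬ Q.service n ω ≤ Q.interarrival n ω := hinf
    have c1 : Set.EqOn (fun t => Real.exp (-(s * |Q.aoi t ω|)))
        (fun t => Real.exp (-(s * (t - Q.heldStamp ω n))))
        (Set.Ioo (Q.arrival n ω) (Q.arrival (n + 1) ω)) := fun t ht => by
      have := Q.arrival_succ n ω
      simp only
      rw [habs t ht.1.le, aoi, stamp_of_lt hI hS ht.1.le ht.2 (by linarith [ht.2])]
    rw [intervalIntegral.integral_congr_Ioo_of_le hmono c1, integral_exp_neg_mul_sub hs,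
      heldStamp, if_neg hinf, Set.indicator_of_notMem
        (show (Q.interarrival n ω, Q.service n ω) ∉ {p : ℝ × ℝ | p.2 ≤ p.1} from hlt)]
    ring

omit hI hS in
/-- `exp (-s W)`, with `W` the age just before an arrival, satisfies an affine recursion. -/
lemma exp_heldAge_succ (s : ℝ) (n : ℕ) :
    Real.exp (-(s * (Q.arrival (n + 1) ω - Q.heldStamp ω (n + 1)))) =
      Real.exp (-(s * (Q.arrival n ω - Q.heldStamp ω n))) *
        {p : ℝ × ℝ | p.1 < p.2}.indicator (fun p => Real.exp (-(s * p.1)))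
          (Q.interarrival n ω, Q.service n ω) +
        {p : ℝ × ℝ | p.2 ≤ p.1}.indicator (fun p => Real.exp (-(s * p.1)))
          (Q.interarrival n ω, Q.service n ω) := by
  have hA := Q.arrival_succ n ω
  rw [heldStamp]
  by_cases hinf : Q.Informative n ω
  · have hle : Q.service n ω ≤ Q.interarrival n ω := hinf
    rw [if_pos hinf, Set.indicator_of_notMem (by simpa using hle),
      Set.indicator_of_mem (by simpa using hle), hA]
    simp
  · have hlt : ¬ Q.service n ω ≤ Q.interarrival n ω := hinf
    rw [if_neg hinf, Set.indicator_of_mem (by simpa using hlt),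
      Set.indicator_of_notMem (by simpa using hlt), hA, add_zero, ← Real.exp_add]
    congr 1; ring

end Path

end GIGIOneQueue

/-! ### Identification of the limit from integer transforms -/

/-- On `[0, 1]`, convergence of moments implies weak convergence. -/
theorem tendsto_of_moments {ι : Type*} {l : Filter ι} {μ : ι → ProbabilityMeasure ℝ}
    {ν : ProbabilityMeasure ℝ} (hμ : ∀ i, ∀ᵐ x ∂(μ i : Measure ℝ), x ∈ Set.Icc (0 : ℝ) 1)
    (hν : ∀ᵐ x ∂(ν : Measure ℝ), x ∈ Set.Icc (0 : ℝ) 1)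
    (h : ∀ k : ℕ, Tendsto (fun i => ∫ x, x ^ k ∂(μ i : Measure ℝ)) l
      (𝓝 (∫ x, x ^ k ∂(ν : Measure ℝ)))) :
    Tendsto μ l (𝓝 ν) := by
  have hint : ∀ (ρ : ProbabilityMeasure ℝ) (_ : ∀ᵐ x ∂(ρ : Measure ℝ), x ∈ Set.Icc (0 : ℝ) 1)
      (k : ℕ), Integrable (fun x : ℝ => x ^ k) (ρ : Measure ℝ) := fun ρ hρ k =>
    Integrable.of_bound (by fun_prop) 1 (by
      filter_upwards [hρ] with x hx
      rw [Real.norm_eq_abs, abs_pow, abs_of_nonneg hx.1]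
      exact pow_le_one₀ hx.1 hx.2)
  have hpe : ∀ (p : Polynomial ℝ) (x : ℝ), p.eval x =
      ∑ k ∈ Finset.range (p.natDegree + 1), p.coeff k * x ^ k := fun p x => p.eval_eq_sum_range x
  have hpi : ∀ (ρ : ProbabilityMeasure ℝ) (_ : ∀ᵐ x ∂(ρ : Measure ℝ), x ∈ Set.Icc (0 : ℝ) 1)
      (p : Polynomial ℝ), Integrable (fun x => p.eval x) (ρ : Measure ℝ) := fun ρ hρ p => by
    simp only [hpe]
    exact integrable_finsetSum _ fun k _ => (hint ρ hρ k).const_mul _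
  have hpoly : ∀ p : Polynomial ℝ, Tendsto (fun i => ∫ x, p.eval x ∂(μ i : Measure ℝ)) l
      (𝓝 (∫ x, p.eval x ∂(ν : Measure ℝ))) := fun p => by
    have e : ∀ (ρ : ProbabilityMeasure ℝ) (_ : ∀ᵐ x ∂(ρ : Measure ℝ), x ∈ Set.Icc (0 : ℝ) 1),
        ∫ x, p.eval x ∂(ρ : Measure ℝ) = ∑ k ∈ Finset.range (p.natDegree + 1),
          p.coeff k * ∫ x, x ^ k ∂(ρ : Measure ℝ) := fun ρ hρ => by
      simp only [hpe]
      rw [integral_finsetSum _ fun k _ => (hint ρ hρ k).const_mul _]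
      simp only [integral_const_mul]
    rw [e ν hν]
    simp only [fun i => e (μ i) (hμ i)]
    exact tendsto_finsetSum _ fun k _ => (h k).const_mul _
  rw [ProbabilityMeasure.tendsto_iff_forall_integral_tendsto]
  intro f
  rw [Metric.tendsto_nhds]
  intro ε hε
  -- Weierstrass: on [0, 1], which carries all the measures, a polynomial replaces `f` at cost ε / 3
  -- under each of them.
  obtain ⟨p, hp⟩ := exists_polynomial_near_of_continuousOn 0 1 f f.continuous.continuousOn (ε / 3)
    (by positivity)
  have hclose : ∀ (ρ : ProbabilityMeasure ℝ) (_ : ∀ᵐ x ∂(ρ : Measure ℝ), x ∈ Set.Icc (0 : ℝ) 1),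
      |∫ x, p.eval x ∂(ρ : Measure ℝ) - ∫ x, f x ∂(ρ : Measure ℝ)| ≤ ε / 3 := fun ρ hρ => by
    rw [← integral_sub (hpi ρ hρ p) (f.integrable _), ← Real.norm_eq_abs]
    refine (norm_integral_le_of_norm_le_const (C := ε / 3) ?_).trans (by simp)
    filter_upwards [hρ] with x hx using (hp x hx).le
  filter_upwards [Metric.tendsto_nhds.1 (hpoly p) (ε / 3) (by positivity)] with i hi
  rw [Real.dist_eq] at hi ⊢
  have h1 := abs_le.1 (hclose (μ i) (hμ i))
  have h2 := abs_le.1 (hclose ν hν)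
  have h3 := abs_lt.1 hi
  rw [abs_lt]; constructor <;> linarith [h1.1, h1.2, h2.1, h2.2, h3.1, h3.2]

lemma integral_cond_Ioc {T : ℝ} (hT : 0 < T) (f : ℝ → ℝ) :
    ∫ t, f t ∂(ProbabilityTheory.cond volume (Set.Ioc 0 T)) = (1 / T) * ∫ t in (0 : ℝ)..T, f t := by
  rw [ProbabilityTheory.cond, integral_smul_measure, intervalIntegral.integral_of_le hT.le, Real.volume_Ioc,
    sub_zero, ENNReal.toReal_inv, ENNReal.toReal_ofReal hT.le, smul_eq_mul, one_div]

/-- If the time averages of `exp (-k f)`, `k = 1, 2, …`, converge to the Laplace-Stieltjes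
transform of a distribution without atoms, then so do the empirical distribution functions. -/
theorem tendsto_empirical_cdf {f : ℝ → ℝ} (hf : Measurable f) (hf0 : ∀ t, 0 ≤ t → 0 ≤ f t)
    {ν : Measure ℝ} [IsProbabilityMeasure ν] [NullSingletonClass ν] (hν : ν (Set.Iio 0) = 0)
    (h : ∀ k : ℕ, 1 ≤ k → Tendsto (fun T : ℝ => (1 / T) *
      ∫ t in (0 : ℝ)..T, Real.exp (-((k : ℝ) * |f t|))) atTop (𝓝 (lst ν k))) (x : ℝ) :
    Tendsto (fun T : ℝ => (1 / T) * ∫ t in (0 : ℝ)..T,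
      Set.indicator (Set.Iic x) (fun _ => (1 : ℝ)) (f t)) atTop (𝓝 (ν.real (Set.Iic x))) := by
  -- The cutoff at 1 makes the uniform law on (0, max T 1] a probability measure for every T; only
  -- large T matter.
  have hpos : ∀ T : ℝ, 0 < max T 1 := fun T => lt_max_of_lt_right one_pos
  have hcond : ∀ T : ℝ, IsProbabilityMeasure (ProbabilityTheory.cond volume (Set.Ioc 0 (max T 1)) : Measure ℝ) :=
    fun T => cond_isProbabilityMeasure_of_finite (by simp) (by simp)
  have hu : Measurable fun t => Real.exp (-|f t|) := by fun_prop
  have he : Measurable fun y : ℝ => Real.exp (-y) := by fun_prop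
  let μ : ℝ → ProbabilityMeasure ℝ := fun T =>
    ⟨(ProbabilityTheory.cond volume (Set.Ioc 0 (max T 1)) : Measure ℝ).map fun t => Real.exp (-|f t|),
      have := hcond T; Measure.isProbabilityMeasure_map hu.aemeasurable⟩
  let ν' : ProbabilityMeasure ℝ := ⟨ν.map fun y => Real.exp (-y),
    Measure.isProbabilityMeasure_map he.aemeasurable⟩
  have hν0 : ∀ᵐ y ∂ν, 0 ≤ y := by
    rw [ae_iff]; simpa [Set.Iio] using hν
  have hconv : Tendsto μ atTop (𝓝 ν') := by
    refine tendsto_of_moments (fun T => ?_) ?_ fun k => ?_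
    · refine (ae_map_iff hu.aemeasurable measurableSet_Icc).2 (Eventually.of_forall fun t => ?_)
      exact ⟨(Real.exp_pos _).le, Real.exp_le_one_iff.2 (by simp)⟩
    · refine (ae_map_iff he.aemeasurable measurableSet_Icc).2 ?_
      filter_upwards [hν0] with y hy
      exact ⟨(Real.exp_pos _).le, Real.exp_le_one_iff.2 (by simpa)⟩
    · rcases Nat.eq_zero_or_pos k with rfl | hk
      · simp
      · have e1 : ∫ x, x ^ k ∂(ν' : Measure ℝ) = lst ν k := by
          change ∫ x, x ^ k ∂(ν.map fun y => Real.exp (-y)) = _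
          rw [integral_map he.aemeasurable (by fun_prop), lst]
          simp only [← Real.exp_nat_mul, mul_neg]
        rw [e1]
        refine (h k hk).congr' ?_
        filter_upwards [eventually_ge_atTop 1] with T hT
        change _ = ∫ x, x ^ k ∂((ProbabilityTheory.cond volume (Set.Ioc 0 (max T 1)) : Measure ℝ).map
          fun t => Real.exp (-|f t|))
        rw [integral_map hu.aemeasurable (by fun_prop), integral_cond_Ioc (hpos T),
          max_eq_left hT]
        simp only [← Real.exp_nat_mul, mul_neg]
  -- The event A ≤ x is exp(-A) ≥ exp(-x), whose boundary is null because `ν` has no atom at x.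
  have hE : MeasurableSet (Set.Ici (Real.exp (-x))) := measurableSet_Ici
  have hpre : (fun y : ℝ => Real.exp (-y)) ⁻¹' Set.Ici (Real.exp (-x)) = Set.Iic x := by
    ext y; simp
  have hnull : (ν' : Measure ℝ) (frontier (Set.Ici (Real.exp (-x)))) = 0 := by
    rw [frontier_Ici]
    change (ν.map fun y => Real.exp (-y)) _ = 0
    rw [Measure.map_apply he (measurableSet_singleton _)]
    have : (fun y : ℝ => Real.exp (-y)) ⁻¹' {Real.exp (-x)} = {x} := by
      ext y; simp
    rw [this, measure_singleton]
  have key := (ENNReal.tendsto_toReal (measure_ne_top _ _)).comp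
    (ProbabilityMeasure.tendsto_measure_of_null_frontier_of_tendsto' hconv hnull)
  have e2 : ((ν' : Measure ℝ) (Set.Ici (Real.exp (-x)))).toReal = ν.real (Set.Iic x) := by
    change ((ν.map fun y => Real.exp (-y)) _).toReal = _
    rw [Measure.map_apply he hE, hpre, Measure.real]
  rw [e2] at key
  refine key.congr' ?_
  filter_upwards [eventually_ge_atTop 1] with T hT
  change (((ProbabilityTheory.cond volume (Set.Ioc 0 (max T 1)) : Measure ℝ).map
    fun t => Real.exp (-|f t|)) (Set.Ici (Real.exp (-x)))).toReal = _
  rw [Measure.map_apply hu hE, ← integral_cond_Ioc (by linarith), max_eq_left hT,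
    ← Measure.real, ← integral_indicator_one (hu hE)]
  refine integral_congr_ae ?_
  filter_upwards [ae_cond_mem (μ := volume) (measurableSet_Ioc (a := (0 : ℝ)) (b := T))] with t ht
  have : |f t| = f t := abs_of_nonneg (hf0 t ht.1.le)
  simp [Set.indicator, this]

/-! ### Long-run law of the age in the GI/GI/1 queue -/

namespace GIGIOneQueue

variable {Ω : Type*} [MeasurableSpace Ω] {P : Measure Ω} [IsProbabilityMeasure P]
  {mG mH : Measure ℝ} (Q : GIGIOneQueue P mG mH)

/-- A long-run distribution of the age is the law of the age if the latter is stationary. -/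
theorem map_aoi_eq_of_stationary {ν : Measure ℝ} [IsProbabilityMeasure ν]
    (hlong : ∀ᵐ ω ∂P, ∀ x : ℝ,
      Tendsto (fun T : ℝ => Q.aoiFraction T x ω) atTop (𝓝 (ν.real (Set.Iic x))))
    (hstat : ∀ t : ℝ, 0 ≤ t → P.map (Q.aoi t) = P.map (Q.aoi 0)) (t : ℝ) (ht : 0 ≤ t) :
    P.map (Q.aoi t) = ν := by
  have hp : IsProbabilityMeasure (P.map (Q.aoi 0)) :=
    Measure.isProbabilityMeasure_map (Q.measurable_aoi 0).aemeasurable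
  rw [hstat t ht]
  refine Measure.ext_of_Iic _ _ fun x => ?_
  rw [← ENNReal.toReal_eq_toReal_iff' (measure_ne_top _ _) (measure_ne_top _ _)]
  have hind : Measurable (Set.indicator (Set.Iic x) fun _ => (1 : ℝ)) :=
    measurable_const.indicator measurableSet_Iic
  have hind0 : ∀ y, 0 ≤ (Set.Iic x).indicator (fun _ => (1 : ℝ)) y := fun y =>
    Set.indicator_nonneg (fun _ _ => zero_le_one) y
  have hind1 : ∀ y, (Set.Iic x).indicator (fun _ => (1 : ℝ)) y ≤ 1 := fun y =>
    Set.indicator_le_self' (fun _ _ => zero_le_one) y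
  have hjoint : ∀ T : ℝ, Integrable (Function.uncurry fun (t : ℝ) (ω : Ω) =>
      Set.indicator (Set.Iic x) (fun _ => (1 : ℝ)) (Q.aoi t ω))
      ((volume.restrict (Set.uIoc 0 T)).prod P) := fun T =>
    have : IsFiniteMeasure (volume.restrict (Set.uIoc 0 T)) := ⟨by simp [Set.uIoc]⟩
    Integrable.of_bound (hind.comp Q.measurable_aoi_uncurry).aestronglyMeasurable 1
      (Eventually.of_forall fun p => by
        rw [Real.norm_eq_abs, Function.uncurry, abs_of_nonneg (hind0 _)]; exact hind1 _)
  -- By Fubini and stationarity, the expected fraction of time equals P(A_0 ≤ x) for each T > 0;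
  -- dominated convergence identifies it with the long-run limit.
  have hval : ∀ᶠ T : ℝ in atTop, ∫ ω, Q.aoiFraction T x ω ∂P =
      ((P.map (Q.aoi 0)) (Set.Iic x)).toReal := by
    filter_upwards [eventually_gt_atTop 0] with T hT
    simp only [aoiFraction]
    rw [integral_const_mul, ← intervalIntegral_integral_swap (hjoint T)]
    have e : Set.EqOn (fun t => ∫ ω, Set.indicator (Set.Iic x) (fun _ => (1 : ℝ)) (Q.aoi t ω) ∂P)
        (fun _ => ((P.map (Q.aoi 0)) (Set.Iic x)).toReal) (Set.uIcc 0 T) := fun t ht => by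
      rw [Set.uIcc_of_le hT.le] at ht
      simp only
      rw [← hstat t ht.1, ← integral_map (Q.measurable_aoi t).aemeasurable
        hind.aestronglyMeasurable, integral_indicator_const _ measurableSet_Iic, Measure.real]
      simp
    rw [intervalIntegral.integral_congr e, intervalIntegral.integral_const]
    rw [sub_zero, smul_eq_mul]
    field_simp
  have hlim : Tendsto (fun T : ℝ => ∫ ω, Q.aoiFraction T x ω ∂P) atTop
      (𝓝 (∫ _, ν.real (Set.Iic x) ∂P)) := by
    refine tendsto_integral_filter_of_dominated_convergence (fun _ => (1 : ℝ)) ?_ ?_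
      (integrable_const _) (hlong.mono fun ω h => h x)
    · filter_upwards [eventually_gt_atTop 0] with T hT
      have := (hjoint T).integral_prod_right
      rw [Set.uIoc_of_le hT.le] at this
      refine (this.const_mul (1 / T)).aestronglyMeasurable.congr (Eventually.of_forall fun ω => ?_)
      simp only [aoiFraction, intervalIntegral.integral_of_le hT.le, Function.uncurry]
    · filter_upwards [eventually_gt_atTop 0] with T hT
      refine Eventually.of_forall fun ω => ?_
      rw [aoiFraction, norm_mul, Real.norm_of_nonneg (by positivity)]
      have := intervalIntegral.norm_integral_le_of_norm_le_const (a := (0 : ℝ)) (b := T) (C := 1)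
        (f := fun t => Set.indicator (Set.Iic x) (fun _ => (1 : ℝ)) (Q.aoi t ω)) fun t _ => by
          rw [Real.norm_eq_abs, abs_of_nonneg (hind0 _)]; exact hind1 _
      rw [sub_zero, abs_of_pos hT, one_mul] at this
      rw [one_div, inv_mul_le_iff₀ hT]; linarith
  have := tendsto_nhds_unique (hlim.congr' hval) tendsto_const_nhds
  rw [← this]
  simp [Measure.real]

/-- Interarrival and service time of packet `n + 1`. -/
def mark (n : ℕ) (ω : Ω) : ℝ × ℝ := (Q.interarrival (n + 1) ω, Q.service (n + 1) ω)

omit [IsProbabilityMeasure P] in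
lemma measurable_mark (n : ℕ) : Measurable (Q.mark n) :=
  (Q.measurable_interarrival _).prodMk (Q.measurable_service _)

lemma map_mark (n : ℕ) : P.map (Q.mark n) = mG.prod mH := by
  have h := Q.indep.indepFun (i := Sum.inl n) (j := Sum.inr n) (by simp)
  have h2 := (indepFun_iff_map_prod_eq_prod_map_map
    (Q.measurable_interarrival (n + 1)).aemeasurable
    (Q.measurable_service (n + 1)).aemeasurable).1 h
  rw [Q.law_interarrival, Q.law_service] at h2
  exact h2

omit [IsProbabilityMeasure P] in
-- The marks before n and the mark n use disjoint blocks of the independent family of interarrival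
-- and service times.
lemma indep_past_mark (n : ℕ) :
    Indep (past Q.mark n) (MeasurableSpace.comap (Q.mark n) inferInstance) P := by
  set F : ℕ ⊕ ℕ → Ω → ℝ := Sum.elim (fun n : ℕ => Q.interarrival (n + 1))
    (fun n : ℕ => Q.service (n + 1)) with hF
  have hm : ∀ i, MeasurableSpace.comap (F i) inferInstance ≤ ‹MeasurableSpace Ω› := by
    rintro (i | i)
    · exact (Q.measurable_interarrival (i + 1)).comap_le
    · exact (Q.measurable_service (i + 1)).comap_le
  have hdisj : Disjoint {i : ℕ ⊕ ℕ | Sum.elim id id i < n} {i : ℕ ⊕ ℕ | Sum.elim id id i = n} :=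
    Set.disjoint_left.2 fun i (h1 : _ < n) (h2 : _ = n) => by omega
  have hcomap : ∀ k, MeasurableSpace.comap (Q.mark k) inferInstance =
      MeasurableSpace.comap (F (Sum.inl k)) inferInstance ⊔
        MeasurableSpace.comap (F (Sum.inr k)) inferInstance := fun k =>
    MeasurableSpace.comap_prodMk _ _
  refine indep_of_indep_of_le_left (indep_of_indep_of_le_right
    (indep_iSup_of_disjoint hm Q.indep hdisj) ?_) ?_
  · rw [hcomap]
    exact sup_le (le_iSup₂_of_le (Sum.inl n) (by simp) le_rfl)
      (le_iSup₂_of_le (Sum.inr n) (by simp) le_rfl)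
  · refine iSup₂_le fun k hk => ?_
    rw [hcomap]
    exact sup_le (le_iSup₂_of_le (Sum.inl k) (by simpa using hk) le_rfl)
      (le_iSup₂_of_le (Sum.inr k) (by simpa using hk) le_rfl)

lemma isProbabilityMeasure_interarrival (Q : GIGIOneQueue P mG mH) : IsProbabilityMeasure mG := by
  rw [← Q.law_interarrival 0]
  exact Measure.isProbabilityMeasure_map (Q.measurable_interarrival 1).aemeasurable

lemma isProbabilityMeasure_service (Q : GIGIOneQueue P mG mH) : IsProbabilityMeasure mH := by
  rw [← Q.law_service 0]
  exact Measure.isProbabilityMeasure_map (Q.measurable_service 1).aemeasurable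

omit [IsProbabilityMeasure P] in
lemma ae_nonneg_interarrival (Q : GIGIOneQueue P mG mH) : ∀ᵐ x ∂mG, 0 ≤ x := by
  rw [← Q.law_interarrival 0]
  exact (ae_map_iff (Q.measurable_interarrival 1).aemeasurable measurableSet_Ici).2
    (Q.interarrival_nonneg 1)

omit [IsProbabilityMeasure P] in
lemma ae_nonneg_service (Q : GIGIOneQueue P mG mH) : ∀ᵐ x ∂mH, 0 ≤ x := by
  rw [← Q.law_service 0]
  exact (ae_map_iff (Q.measurable_service 1).aemeasurable measurableSet_Ici).2
    (Q.service_nonneg 1)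

omit [IsProbabilityMeasure P] in
/-- The renewal law of large numbers for the arrival process. -/
lemma ae_tendsto_arrival (hG : Integrable (fun x : ℝ => x) mG) :
    ∀ᵐ ω ∂P, Tendsto (fun n : ℕ => (n : ℝ)⁻¹ * Q.arrival (n + 1) ω) atTop (𝓝 (distMean mG)) := by
  have hm : ∀ n, AEMeasurable (Q.interarrival n) P := fun n =>
    (Q.measurable_interarrival n).aemeasurable
  have hi : Integrable (Q.interarrival 1) P := by
    rw [← Q.law_interarrival 0] at hG
    exact (integrable_map_measure (by fun_prop) (hm 1)).1 hG
  have hE : ∫ ω, Q.interarrival 1 ω ∂P = distMean mG := by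
    have h := integral_map (hm 1) (f := fun x : ℝ => x) (by fun_prop)
    rw [Q.law_interarrival 0] at h
    exact h.symm
  have := strong_law_ae_real (μ := P) (fun n => Q.interarrival (n + 1)) hi
    (fun i j hij => Q.indep.indepFun (i := Sum.inl i) (j := Sum.inl j) (by simpa using hij))
    (fun i => ⟨hm _, hm _, by rw [Q.law_interarrival, Q.law_interarrival]⟩)
  filter_upwards [this] with ω hω
  have h2 := hω.add (tendsto_inv_atTop_nhds_zero_nat.mul_const (Q.arrival 1 ω))
  simp only [zero_add, zero_mul, add_zero, hE] at h2
  refine h2.congr fun n => ?_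
  have e : Q.arrival (n + 1) ω = Q.arrival 1 ω +
      ∑ i ∈ Finset.range n, Q.interarrival (i + 1) ω := by
    simp only [arrival, Finset.sum_range_succ', Finset.sum_range_zero]; ring
  rw [e]; ring

/-- The long-run average of `exp (-s A)`. -/
theorem ae_tendsto_average_exp_aoi (hG : Integrable (fun x : ℝ => x) mG) (hG0 : 0 < distMean mG)
    (hp : (mG.prod mH) {p | p.2 ≤ p.1} ≠ 0) {s : ℝ} (hs : 0 < s) :
    ∀ᵐ ω ∂P, Tendsto (fun T : ℝ => (1 / T) * ∫ t in (0 : ℝ)..T, Real.exp (-(s * |Q.aoi t ω|)))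
      atTop (𝓝 (residualLst mG s *
        ((∫ p, {p : ℝ × ℝ | p.2 ≤ p.1}.indicator (fun p => Real.exp (-(s * p.2))) p ∂(mG.prod mH)) /
        (1 - ∫ p, {p : ℝ × ℝ | p.1 < p.2}.indicator (fun p => Real.exp (-(s * p.1))) p
          ∂(mG.prod mH))))) := by
  have := Q.isProbabilityMeasure_interarrival
  have := Q.isProbabilityMeasure_service
  have hS1 : MeasurableSet {p : ℝ × ℝ | p.2 ≤ p.1} := measurableSet_le measurable_snd measurable_fst
  have hS2 : MeasurableSet {p : ℝ × ℝ | p.1 < p.2} := measurableSet_lt measurable_fst measurable_snd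
  have hx : ∀ᵐ p ∂(mG.prod mH), 0 ≤ p.1 := Measure.quasiMeasurePreserving_fst.ae
    Q.ae_nonneg_interarrival
  have hy : ∀ᵐ p ∂(mG.prod mH), 0 ≤ p.2 := Measure.quasiMeasurePreserving_snd.ae
    Q.ae_nonneg_service
  have hexp : ∀ z : ℝ, Real.exp (-(s * |z|)) ≤ 1 := fun z =>
    Real.exp_le_one_iff.2 (by have := mul_nonneg hs.le (abs_nonneg z); linarith)
  -- Times are nonnegative only almost surely. The absolute values make the bounds by 1 hold
  -- everywhere without changing the integrals.
  let a : ℝ × ℝ → ℝ := {p : ℝ × ℝ | p.1 < p.2}.indicator fun p => Real.exp (-(s * |p.1|))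
  let b : ℝ × ℝ → ℝ := {p : ℝ × ℝ | p.2 ≤ p.1}.indicator fun p => Real.exp (-(s * |p.1|))
  let c : ℝ × ℝ → ℝ := {p : ℝ × ℝ | p.2 ≤ p.1}.indicator fun p => Real.exp (-(s * |p.2|))
  have ham : Measurable a := Measurable.indicator (by fun_prop) hS2
  have hbm : Measurable b := Measurable.indicator (by fun_prop) hS1
  have hcm : Measurable c := Measurable.indicator (by fun_prop) hS1
  have ha0 : ∀ p, 0 ≤ a p := fun p => Set.indicator_nonneg (fun _ _ => (Real.exp_pos _).le) p
  have hb0 : ∀ p, 0 ≤ b p := fun p => Set.indicator_nonneg (fun _ _ => (Real.exp_pos _).le) p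
  have hc0 : ∀ p, 0 ≤ c p := fun p => Set.indicator_nonneg (fun _ _ => (Real.exp_pos _).le) p
  have hc1 : ∀ p, c p ≤ 1 := fun p => Set.indicator_le' (fun p _ => hexp p.2)
    (fun _ _ => zero_le_one) p
  have habeq : ∀ p, a p + b p = Real.exp (-(s * |p.1|)) := fun p => by
    simp only [a, b, Set.indicator, Set.mem_ofPred_eq]
    by_cases h : p.1 < p.2
    · simp [h, not_le.2 h]
    · simp [h, not_lt.1 h]
  have hab : ∀ p, a p + b p ≤ 1 := fun p => (habeq p).trans_le (hexp _)
  -- As exponentials do not vanish, `a = 0` on every delivered pair, an event of positive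
  -- probability.
  have hz : (mG.prod mH) {p | a p = 0} ≠ 0 := fun h0 =>
    hp (measure_mono_null (fun p hp' => by
      simpa [a, Set.indicator] using hp') h0)
  have hai : Integrable a (mG.prod mH) := Integrable.of_bound ham.aestronglyMeasurable 1
    (Eventually.of_forall fun p => by
      rw [Real.norm_eq_abs, abs_of_nonneg (ha0 p)]; linarith [hab p, hb0 p])
  have hbi : Integrable b (mG.prod mH) := Integrable.of_bound hbm.aestronglyMeasurable 1
    (Eventually.of_forall fun p => by
      rw [Real.norm_eq_abs, abs_of_nonneg (hb0 p)]; linarith [hab p, ha0 p])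
  have ea : ∫ p, {p : ℝ × ℝ | p.1 < p.2}.indicator (fun p => Real.exp (-(s * p.1))) p
      ∂(mG.prod mH) = ∫ p, a p ∂(mG.prod mH) := integral_congr_ae (by
    filter_upwards [hx] with p h
    simp only [a, Set.indicator, abs_of_nonneg h])
  have ec : ∫ p, {p : ℝ × ℝ | p.2 ≤ p.1}.indicator (fun p => Real.exp (-(s * p.2))) p
      ∂(mG.prod mH) = ∫ p, c p ∂(mG.prod mH) := integral_congr_ae (by
    filter_upwards [hy] with p h
    simp only [c, Set.indicator, abs_of_nonneg h])
  have eab : ∫ p, a p ∂(mG.prod mH) + ∫ p, b p ∂(mG.prod mH) = lst mG s := by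
    rw [← integral_add hai hbi]
    simp only [habeq]
    rw [integral_fun_fst (fun x => Real.exp (-(s * |x|))), probReal_univ, one_smul, lst]
    refine integral_congr_ae ?_
    filter_upwards [Q.ae_nonneg_interarrival] with x h
    rw [abs_of_nonneg h]
  have hEa : ∫ p, a p ∂(mG.prod mH) < 1 := by
    have hsub : Integrable (fun p => 1 - a p) (mG.prod mH) := (integrable_const _).sub hai
    have hpos : 0 < ∫ p, (1 - a p) ∂(mG.prod mH) := by
      rw [integral_pos_iff_support_of_nonneg (fun p => by
        have := hab p; have := hb0 p; simp only [Pi.zero_apply]; linarith)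
        hsub]
      refine pos_iff_ne_zero.2 fun h0 => hz (measure_mono_null (fun p hp' => ?_) h0)
      have : a p = 0 := hp'
      simp [this]
    rw [integral_sub (integrable_const _) hai] at hpos
    simp at hpos
    linarith
  have hI : ∀ᵐ ω ∂P, ∀ n, 0 ≤ Q.interarrival n ω := ae_all_iff.2 Q.interarrival_nonneg
  have hS : ∀ᵐ ω ∂P, ∀ n, 0 ≤ Q.service n ω := ae_all_iff.2 Q.service_nonneg
  filter_upwards [hI, hS, Q.ae_tendsto_arrival hG, ae_tendsto_average_affine_recursion
    Q.measurable_mark Q.map_mark Q.indep_past_mark ham hbm hcm ha0 hb0 hc0 hab hc1 hz]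
    with ω hI hS harr havg
  -- The shift by one starts the recursion at packet 1, since packet 0 belongs to the arbitrary
  -- initial state.
  let V : ℕ → ℝ := fun n =>
    Real.exp (-(s * (Q.arrival (n + 1) ω - Q.heldStamp ω (n + 1))))
  have hV0 : ∀ n, 0 ≤ V n := fun n => (Real.exp_pos _).le
  have hV1 : ∀ n, V n ≤ 1 := fun n => Real.exp_le_one_iff.2 (by
    have := mul_nonneg hs.le (sub_nonneg.2 (heldStamp_le_arrival (Q := Q) hI (n + 1)))
    linarith)
  have hVrec : ∀ n, V (n + 1) = V n * a (Q.mark n ω) + b (Q.mark n ω) := fun n => by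
    have := exp_heldAge_succ (Q := Q) (ω := ω) s (n + 1)
    simp only [V, this, a, b, mark, Set.indicator, abs_of_nonneg (hI (n + 1))]
  have hlim := havg V hVrec
  have hfm : Measurable fun t => Real.exp (-(s * |Q.aoi t ω|)) := by
    have := Q.measurable_aoi_path ω
    fun_prop
  have hf1 : ∀ t, |Real.exp (-(s * |Q.aoi t ω|))| ≤ 1 := fun t => by
    rw [abs_of_pos (Real.exp_pos _)]; exact hexp _
  have hii : ∀ u v, IntervalIntegrable (fun t => Real.exp (-(s * |Q.aoi t ω|))) volume u v :=
    fun u v => (intervalIntegrable_const (c := (1 : ℝ))).mono_fun hfm.aestronglyMeasurable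
      (Eventually.of_forall fun t => by simpa using hf1 t)
  have hJ : ∀ n : ℕ, ∫ t in Q.arrival (0 + 1) ω..Q.arrival (n + 1) ω,
      Real.exp (-(s * |Q.aoi t ω|)) =
      (V 0 - V n + ∑ i ∈ Finset.range n, c (Q.mark i ω) * (1 - V i)) / s := fun n => by
    rw [← intervalIntegral.sum_integral_adjacent_intervals
      (a := fun i => Q.arrival (i + 1) ω) (fun k _ => hii _ _), ← Finset.sum_range_sub',
      ← Finset.sum_add_distrib, Finset.sum_div]
    refine Finset.sum_congr rfl fun i _ => ?_
    rw [integral_exp_aoi_period hI hS hs.ne']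
    simp only [V, c, mark, Set.indicator, abs_of_nonneg (hS (i + 1))]
  have hVn : Tendsto (fun n : ℕ => (n : ℝ)⁻¹ * (V 0 - V n)) atTop (𝓝 0) := by
    refine squeeze_zero_norm (fun n => ?_) tendsto_inv_atTop_nhds_zero_nat
    rw [norm_mul, Real.norm_of_nonneg (by positivity), Real.norm_eq_abs]
    refine mul_le_of_le_one_right (by positivity) (abs_le.2 ⟨?_, ?_⟩) <;>
      linarith [hV0 0, hV1 0, hV0 n, hV1 n]
  have hJlim := (hVn.add hlim).div_const s
  have hfinal := tendsto_time_average hfm hf1 (τ := fun n => Q.arrival (n + 1) ω) hG0 harr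
    (hJlim.congr fun n => by rw [hJ]; ring)
  convert hfinal using 2
  -- Since E a + E b = g*(s), the factor 1 - E b / (1 - E a) equals (1 - g*(s)) / (1 - E a).
  rw [ea, ec, residualLst, ← eab]
  have : 1 - ∫ p, a p ∂(mG.prod mH) ≠ 0 := by linarith
  field_simp
  ring

/-- The stationary distribution of the age of information is identified by its transform. -/
theorem isAoILaw_of_lst (hG : Integrable (fun x : ℝ => x) mG) (hG0 : 0 < distMean mG)
    (hp : (mG.prod mH) {p | p.2 ≤ p.1} ≠ 0) {ν : Measure ℝ} [IsProbabilityMeasure ν] [NullSingletonClass ν]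
    (hν : ν (Set.Iio 0) = 0) (hlst : ∀ s : ℝ, 0 < s → lst ν s = residualLst mG s *
      ((∫ p, {p : ℝ × ℝ | p.2 ≤ p.1}.indicator (fun p => Real.exp (-(s * p.2))) p ∂(mG.prod mH)) /
      (1 - ∫ p, {p : ℝ × ℝ | p.1 < p.2}.indicator (fun p => Real.exp (-(s * p.1))) p
        ∂(mG.prod mH)))) :
    Q.IsAoILaw ν := by
  have hlong : ∀ᵐ ω ∂P, ∀ x : ℝ,
      Tendsto (fun T : ℝ => Q.aoiFraction T x ω) atTop (𝓝 (ν.real (Set.Iic x))) := by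
    have hS : ∀ᵐ ω ∂P, ∀ n, 0 ≤ Q.service n ω := ae_all_iff.2 Q.service_nonneg
    -- Integer arguments suffice, so only countably many null sets are discarded.
    have hE : ∀ᵐ ω ∂P, ∀ k : ℕ, 1 ≤ k → Tendsto (fun T : ℝ => (1 / T) *
        ∫ t in (0 : ℝ)..T, Real.exp (-((k : ℝ) * |Q.aoi t ω|))) atTop (𝓝 (lst ν k)) := by
      refine ae_all_iff.2 fun k => ae_all_iff.2 fun hk => ?_
      have hk' : (0 : ℝ) < k := by exact_mod_cast hk
      rw [hlst k hk']
      exact Q.ae_tendsto_average_exp_aoi hG hG0 hp hk'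
    filter_upwards [hS, hE] with ω hS hE x
    exact tendsto_empirical_cdf (Q.measurable_aoi_path ω)
      (fun t ht => aoi_nonneg hS ((Q.initialStamp_nonpos ω).trans ht)) hν hE x
  exact ⟨inferInstance, hlong, Q.map_aoi_eq_of_stationary hlong⟩

end GIGIOneQueue

/-! ### Laplace–Stieltjes transforms -/

section Laplace

/-- The Laplace-Stieltjes transform as an extended nonnegative number. -/
def elst (m : Measure ℝ) (s : ℝ) : ENNReal := ∫⁻ x, ENNReal.ofReal (Real.exp (-(s * x))) ∂m

lemma lst_eq_toReal (m : Measure ℝ) (s : ℝ) : lst m s = (elst m s).toReal :=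
  integral_eq_lintegral_of_nonneg_ae (Eventually.of_forall fun _ => (Real.exp_pos _).le)
    (by fun_prop)

/-- Extended nonnegative values let Tonelli apply with no integrability condition. -/
lemma elst_conv (μ ν : Measure ℝ) [SFinite ν] (s : ℝ) :
    elst (μ.conv ν) s = elst μ s * elst ν s := by
  have h : ∀ x y : ℝ, ENNReal.ofReal (Real.exp (-(s * (x + y)))) =
      ENNReal.ofReal (Real.exp (-(s * x))) * ENNReal.ofReal (Real.exp (-(s * y))) := fun x y => by
    rw [← ENNReal.ofReal_mul (Real.exp_pos _).le, ← Real.exp_add]; congr 2; ring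
  rw [elst, Measure.lintegral_conv (by fun_prop)]
  simp only [h]
  rw [elst, ← lintegral_mul_const _ (by fun_prop)]
  exact lintegral_congr fun x => lintegral_const_mul _ (by fun_prop)

lemma lst_conv (μ ν : Measure ℝ) [SFinite ν] (s : ℝ) :
    lst (μ.conv ν) s = lst μ s * lst ν s := by
  rw [lst_eq_toReal, elst_conv, ENNReal.toReal_mul, ← lst_eq_toReal, ← lst_eq_toReal]

lemma ae_nonneg_conv {μ ν : Measure ℝ} [SFinite μ] [SFinite ν] (hμ : ∀ᵐ x ∂μ, 0 ≤ x)
    (hν : ∀ᵐ x ∂ν, 0 ≤ x) : ∀ᵐ x ∂(μ.conv ν), 0 ≤ x := by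
  refine (ae_map_iff (by fun_prop) measurableSet_Ici).2 ?_
  filter_upwards [(Measure.quasiMeasurePreserving_fst (ν := ν)).ae hμ,
    (Measure.quasiMeasurePreserving_snd (μ := μ)).ae hν] with p h1 h2
  exact add_nonneg h1 h2

variable {m : Measure ℝ} [IsProbabilityMeasure m]

lemma integrable_exp_neg_mul (h0 : ∀ᵐ x ∂m, 0 ≤ x) {s : ℝ} (hs : 0 ≤ s) :
    Integrable (fun x => Real.exp (-(s * x))) m :=
  Integrable.of_bound (by fun_prop) 1 (by
    filter_upwards [h0] with x hx
    rw [Real.norm_of_nonneg (Real.exp_pos _).le]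
    exact Real.exp_le_one_iff.2 (by have := mul_nonneg hs hx; linarith))

lemma lst_pos (h0 : ∀ᵐ x ∂m, 0 ≤ x) {s : ℝ} (hs : 0 ≤ s) : 0 < lst m s :=
  integral_exp_pos (integrable_exp_neg_mul h0 hs)

lemma lst_lt_one (h0 : ∀ᵐ x ∂m, 0 ≤ x) (hm : 0 < distMean m) {s : ℝ} (hs : 0 < s) :
    lst m s < 1 := by
  have hi := integrable_exp_neg_mul h0 hs.le
  have hpos : 0 < ∫ x, (1 - Real.exp (-(s * x))) ∂m := by
    refine (integral_pos_iff_support_of_nonneg_ae ?_ ((integrable_const 1).sub hi)).2 ?_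
    · filter_upwards [h0] with x hx
      have := Real.exp_le_one_iff.2 (show -(s * x) ≤ 0 by have := mul_nonneg hs.le hx; linarith)
      simpa using this
    -- If exp(-sx) = 1 almost everywhere, then x = 0 almost everywhere, against the positive mean.
    · refine pos_iff_ne_zero.2 fun hz => hm.ne' ?_
      refine integral_eq_zero_of_ae ?_
      filter_upwards [measure_eq_zero_iff_ae_notMem.1 hz] with x hx
      have h1 : 1 - Real.exp (-(s * x)) = 0 := by simpa using hx
      have h2 : Real.exp (-(s * x)) = 1 := by linarith
      rw [Real.exp_eq_one_iff] at h2
      simpa [hs.ne'] using h2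
  rw [integral_sub (integrable_const _) hi] at hpos
  simp only [integral_const, probReal_univ, smul_eq_mul, mul_one] at hpos
  rw [lst]; linarith

/-- The transform is the moment generating function reflected, and every negative argument is
interior to its integrability set. -/
lemma differentiableAt_lst (h0 : ∀ᵐ x ∂m, 0 ≤ x) {s : ℝ} (hs : 0 < s) :
    DifferentiableAt ℝ (lst m) s := by
  have hmem : -s ∈ interior (integrableExpSet id m) := by
    refine mem_interior.2 ⟨Set.Iio 0, fun t ht => ?_, isOpen_Iio, by simpa using hs⟩
    have := integrable_exp_neg_mul h0 (s := -t) (by have : t < 0 := ht; linarith)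
    simpa [integrableExpSet] using this
  have hd := (hasDerivAt_mgf hmem).differentiableAt
  have e : lst m = fun t => mgf id m (-t) := by
    funext t; simp [lst, mgf]
  rw [e]
  exact DifferentiableAt.comp (g := mgf id m) (f := fun t : ℝ => -t) s hd (by fun_prop)

end Laplace

/-! ### Exponential distributions and delivery probabilities -/

section Exponential

variable {r : ℝ}

lemma ae_nonneg_expMeasure (r : ℝ) : ∀ᵐ x ∂(expMeasure r), 0 ≤ x := by
  rw [ae_iff]
  have : {x : ℝ | ¬ 0 ≤ x} = Set.Iio 0 := by ext; simp
  rw [this, expMeasure, gammaMeasure, withDensity_apply _ measurableSet_Iio]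
  exact lintegral_gammaPDF_of_nonpos le_rfl

lemma expMeasure_absolutelyContinuous (r : ℝ) : expMeasure r ≪ volume :=
  withDensity_absolutelyContinuous _ _

/-- One absolutely continuous summand makes the sum absolutely continuous. Both limit laws have an
exponential factor, hence no atoms. -/
lemma nullSingletonClass_conv_expMeasure (μ : Measure ℝ) (hr : 0 < r) :
    NullSingletonClass (μ.conv (expMeasure r)) := by
  have := isProbabilityMeasure_expMeasure hr
  exact ⟨fun x => Measure.conv_absolutelyContinuous (expMeasure_absolutelyContinuous r)
    (measure_singleton x)⟩

lemma integral_expMeasure (hr : 0 < r) (f : ℝ → ℝ) :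
    ∫ x, f x ∂(expMeasure r) = ∫ x in Set.Ioi 0, r * Real.exp (-(r * x)) * f x := by
  have hE : expMeasure r = volume.withDensity fun x => ENNReal.ofReal (exponentialPDFReal r x) :=
    rfl
  rw [hE, integral_withDensity_eq_integral_toReal_smul
    (measurable_exponentialPDFReal r).ennreal_ofReal (Eventually.of_forall fun x =>
      ENNReal.ofReal_lt_top), ← integral_Ici_eq_integral_Ioi,
    ← integral_indicator measurableSet_Ici]
  refine integral_congr_ae (Eventually.of_forall fun x => ?_)
  simp only [smul_eq_mul]
  rw [ENNReal.toReal_ofReal (exponentialPDFReal_nonneg hr x)]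
  by_cases hx : 0 ≤ x
  · simp [Set.indicator, hx, exponentialPDFReal, gammaPDFReal]
  · simp [Set.indicator, hx, exponentialPDFReal, gammaPDFReal]

lemma setIntegral_exp_neg_mul_expMeasure (hr : 0 < r) {s : ℝ} (hs : 0 ≤ s) {y : ℝ} (hy : 0 ≤ y) :
    ∫ x, (Set.Iic y).indicator (fun x => Real.exp (-(s * x))) x ∂(expMeasure r) =
      r / (s + r) * (1 - Real.exp (-((s + r) * y))) := by
  have hne : s + r ≠ 0 := by positivity
  have e : ∀ x, r * Real.exp (-(r * x)) * (Set.Iic y).indicator (fun x => Real.exp (-(s * x))) x =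
      (Set.Iic y).indicator (fun x => r * Real.exp (-((s + r) * (x - 0)))) x := fun x => by
    by_cases hx : x ≤ y
    · rw [Set.indicator_of_mem (by simpa using hx), Set.indicator_of_mem (by simpa using hx),
        mul_assoc, ← Real.exp_add]
      congr 2; ring
    · simp [Set.indicator, hx]
  rw [integral_expMeasure hr]
  simp only [e]
  rw [setIntegral_indicator measurableSet_Iic, Set.Ioi_inter_Iic,
    ← intervalIntegral.integral_of_le hy, intervalIntegral.integral_const_mul,
    integral_exp_neg_mul_sub hne]
  simp only [sub_zero, mul_zero, neg_zero, Real.exp_zero]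
  ring

lemma setIntegral_exp_neg_mul_expMeasure' (hr : 0 < r) {s : ℝ} (hs : 0 ≤ s) {y : ℝ} (hy : 0 ≤ y) :
    ∫ x, (Set.Iio y).indicator (fun x => Real.exp (-(s * x))) x ∂(expMeasure r) =
      r / (s + r) * (1 - Real.exp (-((s + r) * y))) := by
  rw [← setIntegral_exp_neg_mul_expMeasure hr hs hy, integral_indicator measurableSet_Iic,
    integral_indicator measurableSet_Iio]
  refine setIntegral_congr_set ?_
  exact (expMeasure_absolutelyContinuous r).ae_eq (Iio_ae_eq_Iic (μ := volume))

lemma measureReal_Ioi_expMeasure (hr : 0 < r) {y : ℝ} (hy : 0 ≤ y) :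
    (expMeasure r).real (Set.Ioi y) = Real.exp (-(r * y)) := by
  have := isProbabilityMeasure_expMeasure hr
  have h := cdf_expMeasure_eq hr y
  rw [cdf_eq_real, if_pos hy] at h
  have h2 := probReal_compl_eq_one_sub (μ := expMeasure r) (measurableSet_Iic (a := y))
  rw [Set.compl_Iic, h] at h2
  rw [h2]; ring

lemma measureReal_Ici_expMeasure (hr : 0 < r) {y : ℝ} (hy : 0 ≤ y) :
    (expMeasure r).real (Set.Ici y) = Real.exp (-(r * y)) := by
  rw [← measureReal_Ioi_expMeasure hr hy]
  exact measureReal_congr ((expMeasure_absolutelyContinuous r).ae_eq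
    (Ioi_ae_eq_Ici (μ := volume)).symm)

lemma lst_expMeasure (hr : 0 < r) {s : ℝ} (hs : 0 ≤ s) : lst (expMeasure r) s = r / (s + r) := by
  have hsr : 0 < s + r := by positivity
  rw [lst, integral_expMeasure hr]
  have e : ∀ x, r * Real.exp (-(r * x)) * Real.exp (-(s * x)) = r * Real.exp (-(s + r) * x) :=
    fun x => by rw [mul_assoc, ← Real.exp_add]; congr 2; ring
  simp only [e]
  rw [integral_const_mul, integral_exp_mul_Ioi (by linarith), mul_zero, Real.exp_zero]
  field_simp

lemma integral_pow_expMeasure (hr : 0 < r) (n : ℕ) :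
    ∫ x, x ^ n ∂(expMeasure r) = n.factorial / r ^ n := by
  rw [integral_expMeasure hr]
  have h := Real.integral_rpow_mul_exp_neg_mul_Ioi (a := (n : ℝ) + 1) (by positivity) hr
  have e : ∀ x : ℝ, r * Real.exp (-(r * x)) * x ^ n =
      r * (x ^ ((n : ℝ) + 1 - 1) * Real.exp (-(r * x))) := fun x => by
    rw [add_sub_cancel_right, Real.rpow_natCast]; ring
  simp only [e]
  rw [integral_const_mul, h, Real.Gamma_nat_eq_factorial, ← Nat.cast_succ, Real.rpow_natCast]
  field_simp
  rw [Nat.succ_eq_add_one, pow_succ]; field_simp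
  rw [← mul_pow, one_div_mul_cancel hr.ne', one_pow]

lemma integrable_pow_expMeasure (hr : 0 < r) (n : ℕ) :
    Integrable (fun x : ℝ => x ^ n) (expMeasure r) := by
  by_contra h
  have := integral_pow_expMeasure hr n
  -- A non-integrable function has integral 0 by convention, against the positive value just
  -- computed.
  rw [integral_undef h] at this
  have : (0 : ℝ) < n.factorial / r ^ n := by positivity
  linarith

lemma distMean_expMeasure (hr : 0 < r) : distMean (expMeasure r) = 1 / r := by
  have := integral_pow_expMeasure hr 1
  simpa [distMean] using this

lemma residualLst_expMeasure (hr : 0 < r) {s : ℝ} (hs : 0 < s) :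
    residualLst (expMeasure r) s = r / (s + r) := by
  rw [residualLst, lst_expMeasure hr hs.le, distMean_expMeasure hr]
  field_simp
  ring

variable {m : Measure ℝ} [IsProbabilityMeasure m]

lemma integrable_indicator_exp {m₁ m₂ : Measure ℝ} [IsProbabilityMeasure m₁]
    [IsProbabilityMeasure m₂] {S : Set (ℝ × ℝ)} (hS : MeasurableSet S) {f : ℝ × ℝ → ℝ}
    (hf : Measurable f) (hf0 : ∀ᵐ p ∂(m₁.prod m₂), 0 ≤ f p) {s : ℝ} (hs : 0 ≤ s) :
    Integrable (S.indicator fun p => Real.exp (-(s * f p))) (m₁.prod m₂) := by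
  refine Integrable.indicator (Integrable.of_bound (by fun_prop) 1 ?_) hS
  filter_upwards [hf0] with p hp
  rw [Real.norm_of_nonneg (Real.exp_pos _).le]
  exact Real.exp_le_one_iff.2 (by have := mul_nonneg hs hp; linarith)

lemma measurableSet_snd_le_fst : MeasurableSet {p : ℝ × ℝ | p.2 ≤ p.1} :=
  measurableSet_le measurable_snd measurable_fst

lemma measurableSet_fst_lt_snd : MeasurableSet {p : ℝ × ℝ | p.1 < p.2} :=
  measurableSet_lt measurable_fst measurable_snd

/-- This and the next three lemmas compute E c and E a when one time is exponential: conditioning on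
the other time, the exponential tail e^{-ry} shifts the argument of its transform from s to s + r.
-/
lemma integral_delivered_exp_arrivals (hr : 0 < r) (h0 : ∀ᵐ x ∂m, 0 ≤ x) {s : ℝ} (hs : 0 ≤ s) :
    ∫ p, {p : ℝ × ℝ | p.2 ≤ p.1}.indicator (fun p => Real.exp (-(s * p.2))) p
      ∂((expMeasure r).prod m) = lst m (s + r) := by
  have := isProbabilityMeasure_expMeasure hr
  rw [integral_prod_symm _ (integrable_indicator_exp measurableSet_snd_le_fst measurable_snd
    (Measure.quasiMeasurePreserving_snd.ae h0) hs), lst]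
  refine integral_congr_ae ?_
  filter_upwards [h0] with y hy
  have e : ∀ x : ℝ, {p : ℝ × ℝ | p.2 ≤ p.1}.indicator (fun p => Real.exp (-(s * p.2))) (x, y) =
      (Set.Ici y).indicator (fun _ => Real.exp (-(s * y))) x := fun x => by
    simp [Set.indicator]
  simp only [e]
  rw [integral_indicator_const _ measurableSet_Ici, measureReal_Ici_expMeasure hr hy, smul_eq_mul,
    ← Real.exp_add]
  congr 1; ring

lemma integral_overtaken_exp_arrivals (hr : 0 < r) (h0 : ∀ᵐ x ∂m, 0 ≤ x) {s : ℝ} (hs : 0 ≤ s) :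
    ∫ p, {p : ℝ × ℝ | p.1 < p.2}.indicator (fun p => Real.exp (-(s * p.1))) p
      ∂((expMeasure r).prod m) = r / (s + r) * (1 - lst m (s + r)) := by
  have := isProbabilityMeasure_expMeasure hr
  rw [integral_prod_symm _ (integrable_indicator_exp measurableSet_fst_lt_snd measurable_fst
    (Measure.quasiMeasurePreserving_fst.ae (ae_nonneg_expMeasure r)) hs)]
  have e : ∀ x y : ℝ, {p : ℝ × ℝ | p.1 < p.2}.indicator (fun p => Real.exp (-(s * p.1))) (x, y) =
      (Set.Iio y).indicator (fun x => Real.exp (-(s * x))) x := fun x y => by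
    simp [Set.indicator]
  simp only [e]
  have h1 : ∫ y, ∫ x, (Set.Iio y).indicator (fun x => Real.exp (-(s * x))) x ∂(expMeasure r) ∂m =
      ∫ y, r / (s + r) * (1 - Real.exp (-((s + r) * y))) ∂m := integral_congr_ae (by
    filter_upwards [h0] with y hy
    exact setIntegral_exp_neg_mul_expMeasure' hr hs hy)
  rw [h1, integral_const_mul, integral_sub (integrable_const _)
    (integrable_exp_neg_mul h0 (by positivity))]
  simp [lst]

lemma integral_delivered_exp_services (hr : 0 < r) (h0 : ∀ᵐ x ∂m, 0 ≤ x) {s : ℝ} (hs : 0 ≤ s) :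
    ∫ p, {p : ℝ × ℝ | p.2 ≤ p.1}.indicator (fun p => Real.exp (-(s * p.2))) p
      ∂(m.prod (expMeasure r)) = r / (s + r) * (1 - lst m (s + r)) := by
  have := isProbabilityMeasure_expMeasure hr
  rw [integral_prod _ (integrable_indicator_exp measurableSet_snd_le_fst measurable_snd
    (Measure.quasiMeasurePreserving_snd.ae (ae_nonneg_expMeasure r)) hs)]
  have e : ∀ x y : ℝ, {p : ℝ × ℝ | p.2 ≤ p.1}.indicator (fun p => Real.exp (-(s * p.2))) (x, y) =
      (Set.Iic x).indicator (fun y => Real.exp (-(s * y))) y := fun x y => by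
    simp [Set.indicator]
  simp only [e]
  have h1 : ∫ x, ∫ y, (Set.Iic x).indicator (fun y => Real.exp (-(s * y))) y ∂(expMeasure r) ∂m =
      ∫ x, r / (s + r) * (1 - Real.exp (-((s + r) * x))) ∂m := integral_congr_ae (by
    filter_upwards [h0] with x hx
    exact setIntegral_exp_neg_mul_expMeasure hr hs hx)
  rw [h1, integral_const_mul, integral_sub (integrable_const _)
    (integrable_exp_neg_mul h0 (by positivity))]
  simp [lst]

lemma integral_overtaken_exp_services (hr : 0 < r) (h0 : ∀ᵐ x ∂m, 0 ≤ x) {s : ℝ} (hs : 0 ≤ s) :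
    ∫ p, {p : ℝ × ℝ | p.1 < p.2}.indicator (fun p => Real.exp (-(s * p.1))) p
      ∂(m.prod (expMeasure r)) = lst m (s + r) := by
  have := isProbabilityMeasure_expMeasure hr
  rw [integral_prod _ (integrable_indicator_exp measurableSet_fst_lt_snd measurable_fst
    (Measure.quasiMeasurePreserving_fst.ae h0) hs), lst]
  refine integral_congr_ae ?_
  filter_upwards [h0] with x hx
  have e : ∀ y : ℝ, {p : ℝ × ℝ | p.1 < p.2}.indicator (fun p => Real.exp (-(s * p.1))) (x, y) =
      (Set.Ioi x).indicator (fun _ => Real.exp (-(s * x))) y := fun y => by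
    simp [Set.indicator]
  simp only [e]
  rw [integral_indicator_const _ measurableSet_Ioi, measureReal_Ioi_expMeasure hr hx, smul_eq_mul,
    ← Real.exp_add]
  congr 1; ring

/-- At s = 0 the integral is the delivery probability, so the preceding formulas also show that
deliveries occur. -/
lemma measure_delivered_ne_zero {ρ : Measure (ℝ × ℝ)}
    (h : ∫ p, {p : ℝ × ℝ | p.2 ≤ p.1}.indicator (fun p => Real.exp (-(0 * p.2))) p ∂ρ ≠ 0) :
    ρ {p | p.2 ≤ p.1} ≠ 0 := fun hz => h (by
  rw [integral_indicator measurableSet_snd_le_fst, setIntegral_measure_zero _ hz])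

end Exponential

/-! ### The compound law of overtaken packets -/

section Compound

/-- `overtakenConv α κ n` is the `n`-fold convolution of `α`, convolved with `κ`. -/
def overtakenConv (α κ : Measure ℝ) : ℕ → Measure ℝ
  | 0 => κ
  | n + 1 => α.conv (overtakenConv α κ n)

instance isFiniteMeasure_overtakenConv (α κ : Measure ℝ) [IsFiniteMeasure α] [IsFiniteMeasure κ]
    (n : ℕ) : IsFiniteMeasure (overtakenConv α κ n) := by
  induction n with
  | zero => exact ‹IsFiniteMeasure κ›
  | succ n ih => rw [overtakenConv]; infer_instance

lemma elst_overtakenConv (α κ : Measure ℝ) [IsFiniteMeasure α] [IsFiniteMeasure κ] (n : ℕ) (s : ℝ) :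
    elst (overtakenConv α κ n) s = elst α s ^ n * elst κ s := by
  induction n with
  | zero => simp [overtakenConv]
  | succ n ih => rw [overtakenConv, elst_conv, ih, pow_succ]; ring

/-- A geometric series, summed in `ENNReal` so that convergence needs no check. -/
lemma elst_sum_overtakenConv (α κ : Measure ℝ) [IsFiniteMeasure α] [IsFiniteMeasure κ] (s : ℝ) :
    elst (Measure.sum (overtakenConv α κ)) s = (1 - elst α s)⁻¹ * elst κ s := by
  rw [elst, lintegral_sum_measure, ← ENNReal.tsum_geometric, ← ENNReal.tsum_mul_right]
  exact tsum_congr fun n => elst_overtakenConv α κ n s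

lemma ae_nonneg_overtakenConv {α κ : Measure ℝ} [IsFiniteMeasure α] [IsFiniteMeasure κ]
    (hα : ∀ᵐ x ∂α, 0 ≤ x) (hκ : ∀ᵐ x ∂κ, 0 ≤ x) (n : ℕ) : ∀ᵐ x ∂(overtakenConv α κ n), 0 ≤ x := by
  induction n with
  | zero => exact hκ
  | succ n ih => exact ae_nonneg_conv hα ih

lemma elst_zero (m : Measure ℝ) : elst m 0 = m Set.univ := by simp [elst]

/-- Existence of the distribution with transform `E c / (1 - E a)`. -/
theorem exists_compound_law {ρ : Measure (ℝ × ℝ)} [IsProbabilityMeasure ρ]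
    (hx : ∀ᵐ p ∂ρ, 0 ≤ p.1) (hy : ∀ᵐ p ∂ρ, 0 ≤ p.2) (hp : ρ {p | p.2 ≤ p.1} ≠ 0) :
    ∃ C : Measure ℝ, IsProbabilityMeasure C ∧ (∀ᵐ x ∂C, 0 ≤ x) ∧ ∀ s : ℝ, 0 ≤ s →
      lst C s =
        (∫ p, {p : ℝ × ℝ | p.2 ≤ p.1}.indicator (fun p => Real.exp (-(s * p.2))) p ∂ρ) /
        (1 - ∫ p, {p : ℝ × ℝ | p.1 < p.2}.indicator (fun p => Real.exp (-(s * p.1))) p ∂ρ) := by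
  -- `α` is the interarrival time on overtaking and `κ` the service time on delivery. Their masses
  -- add up to 1, so a geometric number of `α`-factors followed by one `κ` has total mass κ / (1 -
  -- α) = 1.
  set α : Measure ℝ := (ρ.restrict {p : ℝ × ℝ | p.1 < p.2}).map Prod.fst with hα
  set κ : Measure ℝ := (ρ.restrict {p : ℝ × ℝ | p.2 ≤ p.1}).map Prod.snd with hκ
  have hα0 : ∀ᵐ x ∂α, 0 ≤ x :=
    (ae_map_iff measurable_fst.aemeasurable measurableSet_Ici).2 (ae_restrict_of_ae hx)
  have hκ0 : ∀ᵐ x ∂κ, 0 ≤ x :=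
    (ae_map_iff measurable_snd.aemeasurable measurableSet_Ici).2 (ae_restrict_of_ae hy)
  have hαu : α Set.univ = ρ {p | p.1 < p.2} := by
    rw [hα, Measure.map_apply measurable_fst MeasurableSet.univ]; simp
  have hκu : κ Set.univ = ρ {p | p.2 ≤ p.1} := by
    rw [hκ, Measure.map_apply measurable_snd MeasurableSet.univ]; simp
  have hsum : α Set.univ + κ Set.univ = 1 := by
    rw [hαu, hκu]
    have : {p : ℝ × ℝ | p.1 < p.2}ᶜ = {p : ℝ × ℝ | p.2 ≤ p.1} := by ext; simp
    rw [← this, measure_add_measure_compl measurableSet_fst_lt_snd, measure_univ]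
  have hα1 : α Set.univ < 1 := by
    rw [← hsum]
    exact ENNReal.lt_add_right (measure_ne_top _ _) (by rwa [hκu])
  have hle : ∀ s : ℝ, 0 ≤ s → elst α s ≤ α Set.univ := fun s hs => by
    rw [← elst_zero]
    refine lintegral_mono_ae ?_
    filter_upwards [hα0] with x hx
    refine ENNReal.ofReal_le_ofReal (Real.exp_le_exp.2 ?_)
    have := mul_nonneg hs hx
    linarith
  have elα : ∀ s, (elst α s).toReal =
      ∫ p, {p : ℝ × ℝ | p.1 < p.2}.indicator (fun p => Real.exp (-(s * p.1))) p ∂ρ := fun s => by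
    rw [← lst_eq_toReal, lst, hα, integral_map measurable_fst.aemeasurable (by fun_prop),
      integral_indicator measurableSet_fst_lt_snd]
  have elκ : ∀ s, (elst κ s).toReal =
      ∫ p, {p : ℝ × ℝ | p.2 ≤ p.1}.indicator (fun p => Real.exp (-(s * p.2))) p ∂ρ := fun s => by
    rw [← lst_eq_toReal, lst, hκ, integral_map measurable_snd.aemeasurable (by fun_prop),
      integral_indicator measurableSet_snd_le_fst]
  refine ⟨Measure.sum (overtakenConv α κ), ⟨?_⟩, ?_, fun s hs => ?_⟩
  · rw [← elst_zero, elst_sum_overtakenConv, elst_zero, elst_zero]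
    have : κ Set.univ = 1 - α Set.univ := by
      rw [← hsum, ENNReal.add_sub_cancel_left (measure_ne_top _ _)]
    rw [this]
    exact ENNReal.inv_mul_cancel (tsub_pos_of_lt hα1).ne' (by simp)
  · exact Measure.ae_sum_iff.2 fun n => ae_nonneg_overtakenConv hα0 hκ0 n
  · rw [lst_eq_toReal, elst_sum_overtakenConv, ENNReal.toReal_mul, ENNReal.toReal_inv,
      ENNReal.toReal_sub_of_le ((hle s hs).trans hα1.le) ENNReal.one_ne_top, elα, elκ,
      ENNReal.toReal_one, inv_mul_eq_div]

end Compound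

/-! ### Residual distributions -/

section Residual

/-- The residual (equilibrium) distribution. -/
def residualMeasure (m : Measure ℝ) : Measure ℝ :=
  (ENNReal.ofReal (distMean m))⁻¹ •
    (volume.restrict (Set.Ioi 0)).withDensity fun t => m (Set.Ioi t)

variable {m : Measure ℝ} [IsProbabilityMeasure m]

omit [IsProbabilityMeasure m] in
-- Layer-cake formula: integrating g against the tail m(t, ∞) is averaging ∫₀ˣ g over x. Powers and
-- exponentials as g give moments, total mass and transform.
lemma lintegral_residualMeasure (h0 : ∀ᵐ x ∂m, 0 ≤ x) {g : ℝ → ℝ} (hg : Continuous g)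
    (hg0 : ∀ t, 0 < t → 0 ≤ g t) :
    ∫⁻ t, ENNReal.ofReal (g t) ∂(residualMeasure m) =
      (ENNReal.ofReal (distMean m))⁻¹ * ∫⁻ x, ENNReal.ofReal (∫ t in (0 : ℝ)..x, g t) ∂m := by
  have hm : Measurable fun t => m (Set.Ioi t) :=
    Antitone.measurable fun a b hab => measure_mono (Set.Ioi_subset_Ioi hab)
  rw [residualMeasure, lintegral_smul_measure, smul_eq_mul,
    lintegral_withDensity_eq_lintegral_mul _ hm (by fun_prop),
    lintegral_comp_eq_lintegral_meas_lt_mul m (f := fun x => x) h0 (by fun_prop)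
      (fun t _ => hg.intervalIntegrable _ _)
      ((ae_restrict_mem measurableSet_Ioi).mono fun t ht => hg0 t ht)]
  rfl

omit [IsProbabilityMeasure m] in
lemma ae_nonneg_residualMeasure : ∀ᵐ x ∂(residualMeasure m), 0 ≤ x := by
  refine Measure.ae_smul_measure ?_ _
  refine (withDensity_absolutelyContinuous _ _).ae_le ?_
  filter_upwards [ae_restrict_mem measurableSet_Ioi] with t ht using le_of_lt ht

omit [IsProbabilityMeasure m] in
lemma lintegral_pow_residualMeasure (h0 : ∀ᵐ x ∂m, 0 ≤ x) (n : ℕ) :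
    ∫⁻ t, ENNReal.ofReal (t ^ n) ∂(residualMeasure m) =
      (ENNReal.ofReal (distMean m))⁻¹ * ∫⁻ x, ENNReal.ofReal (x ^ (n + 1) / (n + 1)) ∂m := by
  rw [lintegral_residualMeasure h0 (by fun_prop) fun t ht => by positivity]
  simp [integral_pow]

omit [IsProbabilityMeasure m] in
lemma integral_pow_residualMeasure (h0 : ∀ᵐ x ∂m, 0 ≤ x) (hm : 0 < distMean m) {n : ℕ}
    (hn : Integrable (fun x : ℝ => x ^ (n + 1)) m) :
    Integrable (fun x : ℝ => x ^ n) (residualMeasure m) ∧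
      ∫ x, x ^ n ∂(residualMeasure m) = distMoment m (n + 1) / ((n + 1) * distMean m) := by
  have hnn : 0 ≤ᵐ[residualMeasure m] fun x => x ^ n := by
    filter_upwards [ae_nonneg_residualMeasure] with x hx using pow_nonneg hx n
  have hnn' : 0 ≤ᵐ[m] fun x => x ^ (n + 1) / ((n : ℝ) + 1) := by
    filter_upwards [h0] with x hx
    exact div_nonneg (pow_nonneg hx _) (by positivity)
  have e := lintegral_pow_residualMeasure h0 n
  rw [← ofReal_integral_eq_lintegral_ofReal (hn.div_const _) hnn', integral_div,
    ← ENNReal.ofReal_inv_of_pos hm, ← ENNReal.ofReal_mul (by positivity)] at e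
  constructor
  · refine (lintegral_ofReal_ne_top_iff_integrable (by fun_prop) hnn).1 ?_
    rw [e]; exact ENNReal.ofReal_ne_top
  · rw [integral_eq_lintegral_of_nonneg_ae hnn (by fun_prop), e, ENNReal.toReal_ofReal]
    · rw [distMoment]; field_simp
    · refine mul_nonneg (by positivity) (div_nonneg (integral_nonneg_of_ae ?_) (by positivity))
      filter_upwards [h0] with x hx using pow_nonneg hx _

omit [IsProbabilityMeasure m] in
lemma isProbabilityMeasure_residualMeasure (h0 : ∀ᵐ x ∂m, 0 ≤ x)
    (hi : Integrable (fun x : ℝ => x) m) (hm : 0 < distMean m) :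
    IsProbabilityMeasure (residualMeasure m) := by
  refine ⟨?_⟩
  have h := lintegral_pow_residualMeasure h0 0
  simp only [pow_zero, ENNReal.ofReal_one, lintegral_const, one_mul, zero_add, pow_one,
    Nat.cast_zero, div_one] at h
  rw [h, ← ofReal_integral_eq_lintegral_ofReal hi h0]
  exact ENNReal.inv_mul_cancel (by simpa [distMean] using hm) ENNReal.ofReal_ne_top

lemma lst_residualMeasure (h0 : ∀ᵐ x ∂m, 0 ≤ x) (hm : 0 < distMean m) {s : ℝ} (hs : 0 < s) :
    lst (residualMeasure m) s = residualLst m s := by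
  rw [lst_eq_toReal, elst, lintegral_residualMeasure h0 (by fun_prop) fun t _ =>
    (Real.exp_pos _).le, ENNReal.toReal_mul, ENNReal.toReal_inv, ENNReal.toReal_ofReal hm.le]
  have hI : ∀ x : ℝ, ∫ t in (0 : ℝ)..x, Real.exp (-(s * t)) = (1 - Real.exp (-(s * x))) / s :=
    fun x => by simpa using integral_exp_neg_mul_sub hs.ne' 0 x 0
  simp only [hI]
  have hnn : 0 ≤ᵐ[m] fun x => (1 - Real.exp (-(s * x))) / s := by
    filter_upwards [h0] with x hx
    have := Real.exp_le_one_iff.2 (show -(s * x) ≤ 0 by have := mul_nonneg hs.le hx; linarith)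
    exact div_nonneg (by linarith) hs.le
  rw [← integral_eq_lintegral_of_nonneg_ae hnn (by fun_prop), integral_div,
    integral_sub (integrable_const _) (integrable_exp_neg_mul h0 hs.le), residualLst]
  simp only [integral_const, probReal_univ, smul_eq_mul, mul_one, lst]
  field_simp

end Residual

/-! ### Moments of sums and moments from transforms -/

section Moments

/-- Binomial formula for the moments of a sum of independent random variables. -/
lemma integral_pow_conv {μ ν : Measure ℝ} [IsProbabilityMeasure μ] [IsProbabilityMeasure ν] {n : ℕ}
    (hμ : ∀ k ≤ n, Integrable (fun x : ℝ => x ^ k) μ)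
    (hν : ∀ k ≤ n, Integrable (fun x : ℝ => x ^ k) ν) :
    Integrable (fun x : ℝ => x ^ n) (μ.conv ν) ∧
      ∫ x, x ^ n ∂(μ.conv ν) = ∑ k ∈ Finset.range (n + 1),
        (∫ x, x ^ k ∂μ) * (∫ x, x ^ (n - k) ∂ν) * (n.choose k) := by
  have hm : Measurable fun p : ℝ × ℝ => p.1 + p.2 := by fun_prop
  have hterm : ∀ k ∈ Finset.range (n + 1), Integrable
      (fun p : ℝ × ℝ => p.1 ^ k * p.2 ^ (n - k) * (n.choose k : ℝ)) (μ.prod ν) := fun k hk =>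
    ((hμ k (by simpa [Nat.lt_succ_iff] using hk)).mul_prod (hν (n - k) (by omega))).mul_const _
  constructor
  · refine (integrable_map_measure (by fun_prop) hm.aemeasurable).2 ?_
    simp only [Function.comp_def, add_pow]
    exact integrable_finsetSum _ hterm
  · rw [Measure.conv, integral_map hm.aemeasurable (by fun_prop)]
    simp only [add_pow]
    rw [integral_finsetSum _ hterm]
    refine Finset.sum_congr rfl fun k _ => ?_
    rw [integral_mul_const, integral_prod_mul (fun x : ℝ => x ^ k) fun y : ℝ => y ^ (n - k)]

lemma integrable_pow_of_le {m : Measure ℝ} [IsFiniteMeasure m] {k n : ℕ} (hkn : k ≤ n)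
    (hn : Integrable (fun x : ℝ => x ^ n) m) : Integrable (fun x : ℝ => x ^ k) m := by
  refine ((integrable_const (1 : ℝ)).add hn.norm).mono' (by fun_prop)
    (Eventually.of_forall fun x => ?_)
  simp only [Pi.add_apply, norm_pow]
  rcases le_total ‖x‖ 1 with h | h
  · have := pow_le_one₀ (n := k) (norm_nonneg x) h
    have := pow_nonneg (norm_nonneg x) n
    linarith
  · have := pow_le_pow_right₀ h hkn
    linarith

/-- Convergence from below of functions whose integrals converge. -/
lemma integrable_and_integral_eq_of_tendsto {m : Measure ℝ} {g : ℕ → ℝ → ℝ} {f : ℝ → ℝ} {c : ℝ}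
    (hf : Measurable f) (hgi : ∀ n, Integrable (g n) m) (hg0 : ∀ n, ∀ᵐ x ∂m, 0 ≤ g n x)
    (hgf : ∀ n, ∀ᵐ x ∂m, g n x ≤ f x)
    (hlim : ∀ᵐ x ∂m, Tendsto (fun n => g n x) atTop (𝓝 (f x)))
    (hc : Tendsto (fun n => ∫ x, g n x ∂m) atTop (𝓝 c)) :
    Integrable f m ∧ ∫ x, f x ∂m = c := by
  have hf0 : 0 ≤ᵐ[m] f := by
    filter_upwards [hg0 0, hgf 0] with x h1 h2 using h1.trans h2
  have hi : Integrable f m := by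
    refine (lintegral_ofReal_ne_top_iff_integrable hf.aestronglyMeasurable hf0).1 ?_
    -- Fatou makes `f` integrable; `f` then serves as its own dominating function.
    have h1 : ∫⁻ x, ENNReal.ofReal (f x) ∂m ≤
        liminf (fun n => ∫⁻ x, ENNReal.ofReal (g n x) ∂m) atTop := by
      refine le_trans (le_of_eq (lintegral_congr_ae ?_))
        (lintegral_liminf_le' fun n => (hgi n).aestronglyMeasurable.aemeasurable.ennreal_ofReal)
      filter_upwards [hlim] with x hx
      exact (((ENNReal.continuous_ofReal.tendsto _).comp hx).liminf_eq).symm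
    have h2 : Tendsto (fun n => ∫⁻ x, ENNReal.ofReal (g n x) ∂m) atTop (𝓝 (ENNReal.ofReal c)) :=
      ((ENNReal.continuous_ofReal.tendsto _).comp hc).congr fun n =>
        ofReal_integral_eq_lintegral_ofReal (hgi n) (hg0 n)
    rw [h2.liminf_eq] at h1
    exact ne_top_of_le_ne_top ENNReal.ofReal_ne_top h1
  refine ⟨hi, tendsto_nhds_unique (tendsto_integral_of_dominated_convergence f
    (fun n => (hgi n).aestronglyMeasurable) hi (fun n => ?_) hlim) hc⟩
  filter_upwards [hg0 n, hgf n] with x h1 h2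
  rwa [Real.norm_of_nonneg h1]

/-- The product (1 + u + u²/2)(1 - u + u²/2) = 1 + u⁴/4 is at least 1. -/
lemma exp_neg_le_quadratic {u : ℝ} (hu : 0 ≤ u) : Real.exp (-u) ≤ 1 - u + u ^ 2 / 2 := by
  have h := Real.quadratic_le_exp_of_nonneg hu
  have hpos : 0 < 1 + u + u ^ 2 / 2 := by positivity
  rw [Real.exp_neg]
  refine (inv_anti₀ hpos h).trans ?_
  rw [inv_le_iff_one_le_mul₀ hpos]
  nlinarith [sq_nonneg (u ^ 2)]

lemma tendsto_one_div_succ_nhdsNE : Tendsto (fun n : ℕ => 1 / ((n : ℝ) + 1)) atTop (𝓝[≠] 0) :=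
  tendsto_nhdsWithin_iff.2 ⟨tendsto_one_div_add_atTop_nhds_zero_nat,
    Eventually.of_forall fun n => (by positivity : 1 / ((n : ℝ) + 1) ≠ 0)⟩

lemma tendsto_one_sub_exp_div (x : ℝ) :
    Tendsto (fun s : ℝ => (1 - Real.exp (-(s * x))) / s) (𝓝[≠] 0) (𝓝 x) := by
  have hd : HasDerivAt (fun s : ℝ => -Real.exp (-(s * x))) x 0 := by
    have h := ((hasDerivAt_id (0 : ℝ)).mul_const x).neg.exp.neg
    convert! h using 1
    simp
  refine (hasDerivAt_iff_tendsto_slope.1 hd).congr fun s => ?_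
  simp only [slope_def_field, sub_zero, zero_mul, neg_zero, Real.exp_zero]
  congr 1; ring

lemma tendsto_second_difference_exp (x : ℝ) :
    Tendsto (fun s : ℝ => (x - (1 - Real.exp (-(s * x))) / s) / s) (𝓝[≠] 0) (𝓝 (x ^ 2 / 2)) := by
  rcases eq_or_ne x 0 with rfl | hx
  · simp
  rw [← tendsto_sub_nhds_zero_iff]
  have hb : Tendsto (fun s : ℝ => |s| * |x| ^ 3) (𝓝[≠] 0) (𝓝 0) := by
    have : Tendsto (fun s : ℝ => |s| * |x| ^ 3) (𝓝 0) (𝓝 (|0| * |x| ^ 3)) :=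
      (Continuous.tendsto (by fun_prop) 0)
    simp only [abs_zero, zero_mul] at this
    exact this.mono_left nhdsWithin_le_nhds
  refine squeeze_zero_norm' ?_ hb
  have hsmall : ∀ᶠ s : ℝ in 𝓝[≠] 0, |-(s * x)| ≤ 1 := by
    have : Tendsto (fun s : ℝ => |-(s * x)|) (𝓝 0) (𝓝 (|-(0 * x)|)) :=
      (Continuous.tendsto (by fun_prop) 0)
    simp only [zero_mul, neg_zero, abs_zero] at this
    exact (this.mono_left nhdsWithin_le_nhds).eventually (ge_mem_nhds one_pos)
  filter_upwards [hsmall, self_mem_nhdsWithin] with s hs hs0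
  have hs0 : s ≠ 0 := hs0
  -- The third-order remainder is at most (2/9) |s x|³; after division by s² it is below |s| |x|³.
  have h := Real.exp_bound hs (n := 3) (by norm_num)
  simp only [Finset.sum_range_succ, Finset.sum_range_zero, Nat.factorial] at h
  norm_num at h
  have e : (x - (1 - Real.exp (-(s * x))) / s) / s - x ^ 2 / 2 =
      (Real.exp (-(s * x)) - (1 + -(s * x) + (s * x) ^ 2 / 2)) / s ^ 2 := by
    field_simp; ring
  rw [e, norm_div, Real.norm_eq_abs, Real.norm_eq_abs, div_le_iff₀ (by positivity)]
  refine h.trans ?_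
  rw [abs_of_pos (by positivity : 0 < s ^ 2), ← sq_abs s]
  have : 0 ≤ |s| ^ 3 * |x| ^ 3 := by positivity
  nlinarith

/-- The first two moments from the expansion of the transform at the origin. -/
theorem moments_of_lst {ν : Measure ℝ} [IsProbabilityMeasure ν] (h0 : ∀ᵐ x ∂ν, 0 ≤ x)
    {φ : ℝ → ℝ} {d : ℝ} (hφ : ∀ s, 0 < s → (1 - lst ν s) / s = φ s) (hd : HasDerivAt φ d 0) :
    (Integrable (fun x : ℝ => x) ν ∧ distMean ν = φ 0) ∧
      (Integrable (fun x : ℝ => x ^ 2) ν ∧ distMoment ν 2 = -2 * d) := by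
  set u : ℕ → ℝ := fun n => 1 / ((n : ℝ) + 1) with hu
  have hupos : ∀ n, 0 < u n := fun n => by positivity
  have hulim : Tendsto u atTop (𝓝[≠] 0) := tendsto_one_div_succ_nhdsNE
  have hgi : ∀ n, Integrable (fun x => (1 - Real.exp (-(u n * x))) / u n) ν := fun n =>
    ((integrable_const _).sub (integrable_exp_neg_mul h0 (hupos n).le)).div_const _
  have hgint : ∀ n, ∫ x, (1 - Real.exp (-(u n * x))) / u n ∂ν = φ (u n) := fun n => by
    rw [integral_div, integral_sub (integrable_const _)
      (integrable_exp_neg_mul h0 (hupos n).le), ← hφ _ (hupos n)]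
    simp [lst]
  have hle : ∀ n x, (1 - Real.exp (-(u n * x))) / u n ≤ x := fun n x => by
    rw [div_le_iff₀ (hupos n)]
    have := Real.add_one_le_exp (-(u n * x))
    linarith
  -- The quotients (1 - e^{-ux}) / u lie below x, converge to it as u → 0, and integrate to φ(u) →
  -- φ(0).
  have hmean : Integrable (fun x : ℝ => x) ν ∧ ∫ x, x ∂ν = φ 0 := by
    refine integrable_and_integral_eq_of_tendsto measurable_id hgi (fun n => ?_)
      (fun n => Eventually.of_forall (hle n)) (Eventually.of_forall fun x =>
        (tendsto_one_sub_exp_div x).comp hulim) ?_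
    · filter_upwards [h0] with x hx
      have := Real.exp_le_one_iff.2
        (show -(u n * x) ≤ 0 by have := mul_nonneg (hupos n).le hx; linarith)
      exact div_nonneg (by linarith) (hupos n).le
    · simp only [hgint]
      exact hd.continuousAt.tendsto.comp (hulim.mono_right nhdsWithin_le_nhds)
  -- The next-order quotients lie below their limit x² / 2 and integrate to minus the slope of φ
  -- between 0 and u, which tends to -d.
  have hsq : Integrable (fun x : ℝ => x ^ 2 / 2) ν ∧ ∫ x, x ^ 2 / 2 ∂ν = -d := by
    refine integrable_and_integral_eq_of_tendsto (by fun_prop)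
      (g := fun n x => (x - (1 - Real.exp (-(u n * x))) / u n) / u n)
      (fun n => (hmean.1.sub (hgi n)).div_const _)
      (fun n => Eventually.of_forall fun x => div_nonneg (by linarith [hle n x]) (hupos n).le)
      (fun n => ?_)
      (Eventually.of_forall fun x => (tendsto_second_difference_exp x).comp hulim) ?_
    · filter_upwards [h0] with x hx
      have h1 := exp_neg_le_quadratic (mul_nonneg (hupos n).le hx)
      have hun := hupos n
      rw [div_le_iff₀ hun, sub_le_iff_le_add, ← sub_le_iff_le_add', le_div_iff₀ hun]
      nlinarith
    · have h1 := ((hasDerivAt_iff_tendsto_slope.1 hd).comp hulim).neg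
      refine h1.congr fun n => ?_
      rw [integral_div, integral_sub hmean.1 (hgi n), hgint, hmean.2]
      simp only [Function.comp_apply, slope_def_field, sub_zero]
      ring
  refine ⟨hmean, ?_, ?_⟩
  · simpa using hsq.1.mul_const 2
  · have h := hsq.2
    rw [integral_div] at h
    rw [distMoment]; linarith

end Moments

lemma measure_Iio_zero {ν : Measure ℝ} (h : ∀ᵐ x ∂ν, 0 ≤ x) : ν (Set.Iio 0) = 0 := by
  have := ae_iff.1 h
  simp only [not_le] at this
  exact this

/-! ### The M/GI/1 and GI/M/1 queues -/

namespace GIGIOneQueue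

variable {Ω : Type*} [MeasurableSpace Ω] {P : Measure Ω} [IsProbabilityMeasure P]

/-- The stationary age distribution for Poisson arrivals. -/
theorem exists_aoiLaw_of_poisson_arrivals {lam : ℝ} (hlam : 0 < lam) {mH : Measure ℝ}
    (Q : GIGIOneQueue P (expMeasure lam) mH) :
    ∃ ν : Measure ℝ, Q.IsAoILaw ν ∧ (∀ᵐ x ∂ν, 0 ≤ x) ∧ ∀ s : ℝ, 0 < s →
      lst ν s = lam * lst mH (s + lam) / (s + lam * lst mH (s + lam)) := by
  have := isProbabilityMeasure_expMeasure hlam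
  have := Q.isProbabilityMeasure_service
  have h0 := Q.ae_nonneg_service
  have hp : ((expMeasure lam).prod mH) {p | p.2 ≤ p.1} ≠ 0 := by
    refine measure_delivered_ne_zero ?_
    rw [integral_delivered_exp_arrivals hlam h0 le_rfl, zero_add]
    exact (lst_pos h0 hlam.le).ne'
  obtain ⟨C, hC, hC0, hClst⟩ := exists_compound_law (ρ := (expMeasure lam).prod mH)
    (Measure.quasiMeasurePreserving_fst.ae (ae_nonneg_expMeasure lam))
    (Measure.quasiMeasurePreserving_snd.ae h0) hp
  have hns := nullSingletonClass_conv_expMeasure C hlam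
  have hν0 : ∀ᵐ x ∂(C.conv (expMeasure lam)), 0 ≤ x :=
    ae_nonneg_conv hC0 (ae_nonneg_expMeasure lam)
  refine ⟨C.conv (expMeasure lam), Q.isAoILaw_of_lst ?_ ?_ hp (measure_Iio_zero hν0)
    fun s hs => ?_, hν0, fun s hs => ?_⟩
  · simpa using integrable_pow_expMeasure hlam 1
  · rw [distMean_expMeasure hlam]; positivity
  · rw [lst_conv, hClst s hs.le, residualLst_expMeasure hlam hs, lst_expMeasure hlam hs.le]
    ring
  · have hpos := lst_pos h0 (s := s + lam) (by positivity)
    -- The residual law of an exponential is that exponential, so it supplies the second convolution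
    -- factor.
    rw [lst_conv, hClst s hs.le, lst_expMeasure hlam hs.le,
      integral_delivered_exp_arrivals hlam h0 hs.le, integral_overtaken_exp_arrivals hlam h0 hs.le]
    have e : 1 - lam / (s + lam) * (1 - lst mH (s + lam)) =
        (s + lam * lst mH (s + lam)) / (s + lam) := by
      field_simp; ring
    rw [e]
    field_simp

/-- The stationary age distribution for exponential services. -/
theorem isAoILaw_of_exp_services {mu : ℝ} (hmu : 0 < mu) {mG : Measure ℝ}
    (Q : GIGIOneQueue P mG (expMeasure mu)) (hG : Integrable (fun x : ℝ => x) mG)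
    (hG0 : 0 < distMean mG) :
    Q.IsAoILaw ((residualMeasure mG).conv (expMeasure mu)) ∧ ∀ s : ℝ, 0 < s →
      lst ((residualMeasure mG).conv (expMeasure mu)) s =
        residualLst mG s * (mu / (s + mu)) := by
  have := isProbabilityMeasure_expMeasure hmu
  have := Q.isProbabilityMeasure_interarrival
  have h0 := Q.ae_nonneg_interarrival
  have := isProbabilityMeasure_residualMeasure h0 hG hG0
  have hp : (mG.prod (expMeasure mu)) {p | p.2 ≤ p.1} ≠ 0 := by
    refine measure_delivered_ne_zero ?_
    rw [integral_delivered_exp_services hmu h0 le_rfl, zero_add, div_self hmu.ne', one_mul]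
    exact (sub_pos.2 (lst_lt_one h0 hG0 hmu)).ne'
  have hns := nullSingletonClass_conv_expMeasure (residualMeasure mG) hmu
  have hlst : ∀ s : ℝ, 0 < s → lst ((residualMeasure mG).conv (expMeasure mu)) s =
      residualLst mG s * (mu / (s + mu)) := fun s hs => by
    rw [lst_conv, lst_residualMeasure h0 hG0 hs, lst_expMeasure hmu hs.le]
  refine ⟨Q.isAoILaw_of_lst hG hG0 hp (measure_Iio_zero
    (ae_nonneg_conv ae_nonneg_residualMeasure (ae_nonneg_expMeasure mu))) fun s hs => ?_, hlst⟩
  -- This factor occurs both in E c and as 1 - E a; cancelling it leaves μ / (s + μ).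
  have hpos : 0 < 1 - lst mG (s + mu) := sub_pos.2 (lst_lt_one h0 hG0 (by positivity))
  rw [hlst s hs, integral_delivered_exp_services hmu h0 hs.le,
    integral_overtaken_exp_services hmu h0 hs.le, mul_div_assoc, div_self hpos.ne', mul_one]

end GIGIOneQueue

/-- Moments of the sum of a residual interarrival time and an exponential service time. -/
theorem integral_pow_residual_conv_exp {mu : ℝ} (hmu : 0 < mu) {mG : Measure ℝ}
    [IsProbabilityMeasure mG] (h0 : ∀ᵐ x ∂mG, 0 ≤ x) (hG0 : 0 < distMean mG) {n : ℕ}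
    (hn : Integrable (fun x : ℝ => x ^ (n + 1)) mG) :
    Integrable (fun x : ℝ => x ^ n) ((residualMeasure mG).conv (expMeasure mu)) ∧
      distMoment ((residualMeasure mG).conv (expMeasure mu)) n =
        ∑ m ∈ Finset.range (n + 1),
          (n.factorial : ℝ) * distMoment mG (m + 1) * distMean (expMeasure mu) ^ (n - m) /
            (((m + 1).factorial : ℝ) * distMean mG) := by
  have := isProbabilityMeasure_expMeasure hmu
  have hG : Integrable (fun x : ℝ => x) mG := by
    simpa using integrable_pow_of_le (k := 1) (by omega) hn
  have := isProbabilityMeasure_residualMeasure h0 hG hG0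
  have hk : ∀ k ≤ n, Integrable (fun x : ℝ => x ^ (k + 1)) mG := fun k hk =>
    integrable_pow_of_le (by omega) hn
  obtain ⟨h1, h2⟩ := integral_pow_conv (μ := residualMeasure mG) (ν := expMeasure mu) (n := n)
    (fun k hkn => (integral_pow_residualMeasure h0 hG0 (hk k hkn)).1)
    (fun k _ => integrable_pow_expMeasure hmu k)
  refine ⟨h1, h2.trans (Finset.sum_congr rfl fun k hkn => ?_)⟩
  have hkn : k ≤ n := by simpa [Nat.lt_succ_iff] using hkn
  rw [(integral_pow_residualMeasure h0 hG0 (hk k hkn)).2, integral_pow_expMeasure hmu,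
    distMean_expMeasure hmu, Nat.cast_choose ℝ hkn, Nat.factorial_succ, one_div, inv_pow]
  have f1 : (k.factorial : ℝ) ≠ 0 := by positivity
  have f2 : ((n - k).factorial : ℝ) ≠ 0 := by positivity
  push_cast
  field_simp

/-- The mean and second moment of a distribution with the age transform for Poisson arrivals. -/
theorem moments_of_poisson_arrivals {lam : ℝ} (hlam : 0 < lam) {mH ν : Measure ℝ}
    [IsProbabilityMeasure mH] [IsProbabilityMeasure ν] (h0 : ∀ᵐ x ∂mH, 0 ≤ x)
    (hν : ∀ᵐ x ∂ν, 0 ≤ x) (hlst : ∀ s : ℝ, 0 < s →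
      lst ν s = lam * lst mH (s + lam) / (s + lam * lst mH (s + lam))) :
    (Integrable (fun x : ℝ => x) ν ∧ distMean ν = 1 / (lam * lst mH lam)) ∧
      (Integrable (fun x : ℝ => x ^ 2) ν ∧ distMoment ν 2 =
        2 * (1 - lam * (-(deriv (lst mH) lam))) * (1 / (lam * lst mH lam)) ^ 2) := by
  have hp := lst_pos h0 hlam.le
  -- The right side is differentiable at s = 0 because the shift by λ keeps h* at positive
  -- arguments; no moment of H enters.
  have hφ : ∀ s, 0 < s → (1 - lst ν s) / s = (s + lam * lst mH (s + lam))⁻¹ := fun s hs => by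
    have := lst_pos h0 (s := s + lam) (by positivity)
    rw [hlst s hs]
    field_simp
    ring
  have hd : HasDerivAt (fun s => (s + lam * lst mH (s + lam))⁻¹)
      (-(1 + lam * deriv (lst mH) lam) / (lam * lst mH lam) ^ 2) 0 := by
    have h1 : HasDerivAt (lst mH) (deriv (lst mH) lam) (0 + lam) := by
      rw [zero_add]; exact (differentiableAt_lst h0 hlam).hasDerivAt
    have h2 := (hasDerivAt_id (0 : ℝ)).add ((h1.comp_add_const 0 lam).const_mul lam)
    have h3 := h2.inv (by simpa using ⟨hlam.ne', hp.ne'⟩)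
    convert! h3 using 1
    simp
  obtain ⟨⟨i1, e1⟩, i2, e2⟩ := moments_of_lst hν hφ hd
  refine ⟨⟨i1, ?_⟩, i2, ?_⟩
  · rw [e1]; simp
  · rw [e2]; field_simp; ring

end

/-! ### Assembly of the two cases -/

theorem corollary10 {Ω : Type*} [MeasurableSpace Ω] (P : Measure Ω) [IsProbabilityMeasure P] :
    -- (i) the preemptive LCFS M/GI/1 queue, with `rho` the traffic intensity
    (∀ (lam : ℝ), 0 < lam → ∀ (mH : Measure ℝ) (Q : GIGIOneQueue P (expMeasure lam) mH)
      (rho : ℝ), rho = lam * distMean mH →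
      ∃ ν : Measure ℝ, Q.IsAoILaw ν ∧
        (∀ s : ℝ, 0 < s →
          lst ν s = lam * lst mH (s + lam) / (s + lam * lst mH (s + lam))) ∧
        (Integrable (fun x : ℝ => x) mH → 0 < distMean mH →
          (Integrable (fun x : ℝ => x) ν ∧
            distMean ν = distMean mH / (rho * lst mH lam)) ∧
          (Integrable (fun x : ℝ => x ^ 2) ν ∧ DifferentiableAt ℝ (lst mH) lam ∧
            distMoment ν 2 = 2 * (1 - lam * (-(deriv (lst mH) lam))) *
              (distMean mH / (rho * lst mH lam)) ^ 2))) ∧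
    -- (ii) the preemptive LCFS GI/M/1 queue
    (∀ (mu : ℝ), 0 < mu → ∀ (mG : Measure ℝ) (Q : GIGIOneQueue P mG (expMeasure mu)),
      Integrable (fun x : ℝ => x) mG → 0 < distMean mG →
      ∃ ν : Measure ℝ, Q.IsAoILaw ν ∧
        (∀ s : ℝ, 0 < s → lst ν s = residualLst mG s * (mu / (s + mu))) ∧
        (∀ n : ℕ, 1 ≤ n → Integrable (fun x : ℝ => x ^ (n + 1)) mG →
          Integrable (fun x : ℝ => x ^ n) ν ∧
          distMoment ν n = ∑ m ∈ Finset.range (n + 1),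
            (n.factorial : ℝ) * distMoment mG (m + 1) * distMean (expMeasure mu) ^ (n - m) /
              (((m + 1).factorial : ℝ) * distMean mG)) ∧
        (Integrable (fun x : ℝ => x ^ 2) mG →
          distMean ν = distMoment mG 2 / (2 * distMean mG) + distMean (expMeasure mu)) ∧
        (Integrable (fun x : ℝ => x ^ 3) mG →
          distMoment ν 2 = distMoment mG 3 / (3 * distMean mG) +
            2 * distMean (expMeasure mu) * distMean ν)) := by
  refine ⟨fun lam hlam mH Q rho hrho => ?_, fun mu hmu mG Q hG hG0 => ?_⟩
  · obtain ⟨ν, hν, hν0, hlst⟩ := Q.exists_aoiLaw_of_poisson_arrivals hlam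
    refine ⟨ν, hν, hlst, fun _ hH0 => ?_⟩
    have := hν.isProbabilityMeasure
    have := Q.isProbabilityMeasure_service
    have h0 := Q.ae_nonneg_service
    have hp := lst_pos h0 hlam.le
    obtain ⟨⟨i1, e1⟩, i2, e2⟩ := moments_of_poisson_arrivals hlam h0 hν0 hlst
    have e : distMean mH / (rho * lst mH lam) = 1 / (lam * lst mH lam) := by
      rw [hrho]; field_simp
    rw [e]
    exact ⟨⟨i1, e1⟩, i2, differentiableAt_lst h0 hlam, e2⟩
  · have := Q.isProbabilityMeasure_interarrival
    have h0 := Q.ae_nonneg_interarrival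
    obtain ⟨hν, hlst⟩ := Q.isAoILaw_of_exp_services hmu hG hG0
    have hmom := fun (n : ℕ) (hn : Integrable (fun x : ℝ => x ^ (n + 1)) mG) =>
      integral_pow_residual_conv_exp hmu h0 hG0 hn
    have hmean : Integrable (fun x : ℝ => x ^ 2) mG →
        distMean ((residualMeasure mG).conv (expMeasure mu)) =
          distMoment mG 2 / (2 * distMean mG) + distMean (expMeasure mu) := fun h2 => by
      -- For n = 1, the term m = 0 is E[H] and the term m = 1 is E[G²] / (2 E[G]).
      have h := (hmom 1 h2).2
      have e1 : distMoment mG 1 = distMean mG := by simp [distMoment, distMean]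
      simp only [Finset.sum_range_succ, Finset.sum_range_zero, Nat.factorial, zero_add, e1] at h
      simp only [distMoment, pow_one] at h
      rw [distMean, h]
      norm_num [distMoment]
      field_simp
      ring
    refine ⟨_, hν, hlst, fun n _ hn => hmom n hn, hmean, fun h3 => ?_⟩
    -- For n = 2, the terms m = 0 and m = 1 are 2 E[H]² and E[H] E[G²] / E[G], together 2 E[H] E[A].
    rw [hmean (integrable_pow_of_le (by norm_num) h3), (hmom 2 h3).2]
    have e1 : distMoment mG 1 = distMean mG := by simp [distMoment, distMean]
    simp only [Finset.sum_range_succ, Finset.sum_range_zero, Nat.factorial, zero_add, e1]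
    norm_num
    field_simp
    ring
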